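/- **Setting.** The Basilica group $B$ is the group generated by the automorphisms $a,b$ of the rooted binary tree given on words over $\{0,1\}$ by $$a(0w)=0\,b(w),\quad a(1w)=1w,\qquad b(0w)=1\,a(w),\quad b(1w)=0w ;$$ it acts on the sets $\{0,1\}^n$ of words of length $n$ and on the set $\{0,1\}^\omega$ of infinite words. The finite Schreier graph $\Gamma_n$ is the unlabelled undirected multigraph with vertex set $\{0,1\}^n$ and with one edge joining $v$ and $s(v)$ for every vertex $v$ and every $s\in\{a,b\}$ (loops and multiple edges are kept). For $\xi\in\{0,1\}^\omega$, the orbital Schreier graph $\Gamma_\xi$ is defined in the same way on the orbit $B\cdot\xi$. Let $E_2$ be the set of all $\xi\in\{0,1\}^\omega$ for which $\Gamma_\xi$ has exactly two ends, an end being an equivalence class of rays, where two rays are equivalent if for every finite set $S$ of vertices they have tails in the same connected component of $\Gamma_\xi\setminus S$. For $k\ge 1$, the *$k$-decoration* is the subgraph of $\Gamma_k$ induced by $0^k$ and all vertices of $\Gamma_k\setminus\{0^k\}$ outside the connected component of $0^{k-1}1$ (for $k=1$ it is a single vertex with a loop). Its root is $0^k$, its unique vertex of degree $2$. Write $\xi=\alpha_1\beta_1\alpha_2\beta_2\dots$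 with $\alpha_i,\beta_i\in\{0,1\}$, and let $E_{2,even}$ (respectively $E_{2,odd}$) be the set of those $\xi\in E_2$ for which only finitely many of the $\alpha_i$ (respectively of the $\beta_i$) are equal to $1$. For $\xi\in E_{2,even}$ put $$A'_0=2\mathbb Z,\qquad A'_k=\Big\{n\in\mathbb Z : n\equiv 2^k-1-\sum_{i=1}^k 2^i\beta_{i+1} \bmod 2^{k+1}\Big\}\quad(k\ge 1),$$ and let $\Gamma(\xi)$ be the straight line with vertex set $\mathbb Z$ (one edge joining $n$ and $n+1$ for every $n$) in which, for every $k\ge 0$, a copy of the $(2k+2)$-decoration is attached by its root to every vertex $n\in A'_k$. For $\xi\in E_{2,odd}$, define $A'_k$ and $\Gamma(\xi)$ in the same way, with $\alpha_{i+1}$ in place of $\beta_{i+1}$ and $(2k+1)$-decorations in place of $(2k+2)$-decorations. **Theorem.** Let $\xi\in E_2$. Then $\xi$ belongs to exactly one of $E_{2,even}$ and $E_{2,odd}$; the graph $\Gamma(\xi)$ is well defined, that is, every integer $n$ lies in $A'_k$ for exactly one $k\ge 0$; and $\Gamma_\xi$ is isomorphic to $\Gamma(\xi)$ as an unrooted,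 unlabelled multigraph. -/

import Mathlib

namespace BasilicaSchreier

/-! ### Multigraphs: isomorphism, components, ends -/

/-- An isomorphism of (unlabelled, unrooted) multigraphs: a bijection of the vertices together with
a bijection of the edges which preserves the two ends of every edge. -/
structure GraphIso {V₁ E₁ V₂ E₂ : Type*} (G : Graph V₁ E₁) (H : Graph V₂ E₂) where
  /-- the bijection of the vertices -/
  vertexEquiv : G.vertexSet ≃ H.vertexSet
  /-- the bijection of the edges -/
  edgeEquiv : G.edgeSet ≃ H.edgeSet
  /-- the ends of every edge are preserved -/
  isLink_iff : ∀ (e : G.edgeSet) (x y : G.vertexSet),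
    G.IsLink e x y ↔ H.IsLink (edgeEquiv e) (vertexEquiv x) (vertexEquiv y)

/-- `x` and `y` are vertices of `G` in the same connected component of `G`. -/
def SameComponent {V E : Type*} (G : Graph V E) (x y : V) : Prop :=
  x ∈ G.vertexSet ∧ Relation.ReflTransGen G.Adj x y

theorem SameComponent.right_mem {V E : Type*} {G : Graph V E} {x y : V}
    (h : SameComponent G x y) : y ∈ G.vertexSet := by
  obtain ⟨hx, h⟩ := h
  cases h with
  | refl => exact hx
  | tail _ h => exact h.right_mem

theorem SameComponent.symm {V E : Type*} {G : Graph V E} {x y : V}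
    (h : SameComponent G x y) : SameComponent G y x := by
  refine ⟨h.right_mem, ?_⟩
  obtain ⟨-, h⟩ := h
  induction h with
  | refl => exact Relation.ReflTransGen.refl
  | tail _ h ih => exact Relation.ReflTransGen.head (Graph.Adj.symm h) ih

theorem SameComponent.trans {V E : Type*} {G : Graph V E} {x y z : V}
    (h : SameComponent G x y) (h' : SameComponent G y z) : SameComponent G x z :=
  ⟨h.1, h.2.trans h'.2⟩

/-- A ray: an infinite sequence of distinct vertices, any two consecutive ones being adjacent. -/
structure Ray {V E : Type*} (G : Graph V E) where
  /-- the sequence of vertices -/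
  vertex : ℕ → V
  /-- the vertices are distinct -/
  injective : Function.Injective vertex
  /-- consecutive vertices are adjacent -/
  adj : ∀ n, G.Adj (vertex n) (vertex (n + 1))

/-- Two rays are equivalent if for every finite set `S` of vertices they have tails in the same
component of `G ∖ S`. -/
def RayEquiv {V E : Type*} {G : Graph V E} (r r' : Ray G) : Prop :=
  ∀ S : Set V, S.Finite → ∃ N : ℕ, ∀ m ≥ N, ∀ n ≥ N,
    SameComponent (G.deleteVerts S) (r.vertex m) (r'.vertex n)

theorem RayEquiv.refl {V E : Type*} {G : Graph V E} (r : Ray G) : RayEquiv r r := by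
  intro S hS
  have hfin : (r.vertex ⁻¹' S).Finite := hS.preimage r.injective.injOn
  obtain ⟨N, hN⟩ := hfin.bddAbove
  have hout : ∀ m ≥ N + 1, r.vertex m ∉ S := fun m hm hmem => by
    have := hN (show m ∈ r.vertex ⁻¹' S from hmem)
    omega
  have hmem : ∀ m ≥ N + 1, r.vertex m ∈ (G.deleteVerts S).vertexSet := fun m hm => by
    rw [Graph.vertexSet_deleteVerts]
    exact ⟨(r.adj m).left_mem, hout m hm⟩
  have key : ∀ m ≥ N + 1, ∀ d : ℕ,
      SameComponent (G.deleteVerts S) (r.vertex m) (r.vertex (m + d)) := by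
    intro m hm d
    induction d with
    | zero => exact ⟨hmem m hm, Relation.ReflTransGen.refl⟩
    | succ d ih =>
      refine ⟨ih.1, ih.2.tail ?_⟩
      obtain ⟨e, he⟩ := r.adj (m + d)
      refine ⟨e, ?_⟩
      rw [Graph.deleteVerts_isLink]
      exact ⟨he, hout _ (by omega), hout _ (by omega)⟩
  refine ⟨N + 1, fun m hm n hn => ?_⟩
  rcases le_total m n with h | h
  · obtain ⟨d, rfl⟩ := Nat.exists_eq_add_of_le h
    exact key m hm d
  · obtain ⟨d, rfl⟩ := Nat.exists_eq_add_of_le h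
    exact (key n hn d).symm

/-- Equivalence of rays is an equivalence relation. -/
def raySetoid {V E : Type*} (G : Graph V E) : Setoid (Ray G) where
  r := RayEquiv
  iseqv :=
    { refl := RayEquiv.refl
      symm := fun {r r'} h S hS => by
        obtain ⟨N, hN⟩ := h S hS
        exact ⟨N, fun m hm n hn => (hN n hn m hm).symm⟩
      trans := fun {r r' r''} h h' S hS => by
        obtain ⟨N, hN⟩ := h S hS
        obtain ⟨M, hM⟩ := h' S hS
        exact ⟨max N M, fun m hm n hn =>
          (hN m (le_of_max_le_left hm) (max N M) (le_max_left _ _)).trans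
            (hM (max N M) (le_max_right _ _) n (le_of_max_le_right hn))⟩ }

/-- The ends of `G`: equivalence classes of rays. -/
def Ends {V E : Type*} (G : Graph V E) : Type _ := Quotient (raySetoid G)

/-- `G` has exactly `i` ends. -/
def HasEnds {V E : Type*} (G : Graph V E) (i : ℕ) : Prop :=
  Nonempty (Ends G ≃ Fin i)

/-! ### Automata and their action on finite and infinite words -/

/-- An invertible automaton over the alphabet `X` with set of states `S`: for every state the
output map is a permutation of `X`. -/
structure InvAutomaton (S X : Type*) where
  /-- the transition map -/
  trans : S → X → S
  /-- the output map -/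
  out : S → Equiv.Perm X

namespace InvAutomaton

/-- The transformation of finite words defined by the automaton with initial state `s`. -/
def onWord {S X : Type*} (A : InvAutomaton S X) : S → List X → List X
  | _, [] => []
  | s, x :: w => A.out s x :: A.onWord (A.trans s x) w

/-- The state of the automaton after reading the first `n` letters of `ξ` from the state `s`. -/
def stateAt {S X : Type*} (A : InvAutomaton S X) (s : S) (ξ : ℕ → X) : ℕ → S
  | 0 => s
  | n + 1 => A.trans (A.stateAt s ξ n) (ξ n)

/-- The transformation of infinite words defined by the automaton with initial state `s`. -/
def onSeq {S X : Type*} (A : InvAutomaton S X) (s : S) (ξ : ℕ → X) : ℕ → X :=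
  fun n => A.out (A.stateAt s ξ n) (ξ n)

/-- The inverse automaton. -/
def inv {S X : Type*} (A : InvAutomaton S X) : InvAutomaton S X where
  trans s y := A.trans s ((A.out s).symm y)
  out s := (A.out s).symm

theorem inv_inv {S X : Type*} (A : InvAutomaton S X) : A.inv.inv = A := by
  simp [inv]

theorem inv_onWord_onWord {S X : Type*} (A : InvAutomaton S X) (s : S) (w : List X) :
    A.inv.onWord s (A.onWord s w) = w := by
  induction w generalizing s with
  | nil => rfl
  | cons x w ih => simp [onWord, inv] at ih ⊢; exact ih _

theorem stateAt_inv_onSeq {S X : Type*} (A : InvAutomaton S X) (s : S) (ξ : ℕ → X) (n : ℕ) :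
    A.inv.stateAt s (A.onSeq s ξ) n = A.stateAt s ξ n := by
  induction n with
  | zero => rfl
  | succ n ih => simp only [stateAt, ih]; simp [inv, onSeq]

theorem inv_onSeq_onSeq {S X : Type*} (A : InvAutomaton S X) (s : S) (ξ : ℕ → X) :
    A.inv.onSeq s (A.onSeq s ξ) = ξ := by
  funext n
  change A.inv.out (A.inv.stateAt s (A.onSeq s ξ) n) (A.onSeq s ξ n) = ξ n
  rw [stateAt_inv_onSeq]
  simp [inv, onSeq]

/-- The permutation of the set of finite words defined by the state `s`. -/
def wordPerm {S X : Type*} (A : InvAutomaton S X) (s : S) : Equiv.Perm (List X) where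
  toFun := A.onWord s
  invFun := A.inv.onWord s
  left_inv := A.inv_onWord_onWord s
  right_inv w := by simpa [inv_inv] using A.inv.inv_onWord_onWord s w

/-- The permutation of the set of infinite words defined by the state `s`. -/
def seqPerm {S X : Type*} (A : InvAutomaton S X) (s : S) : Equiv.Perm (ℕ → X) where
  toFun := A.onSeq s
  invFun := A.inv.onSeq s
  left_inv := A.inv_onSeq_onSeq s
  right_inv ξ := by simpa [inv_inv] using A.inv.inv_onSeq_onSeq s ξ

theorem length_onWord {S X : Type*} (A : InvAutomaton S X) (s : S) (w : List X) :
    (A.onWord s w).length = w.length := by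
  induction w generalizing s with
  | nil => rfl
  | cons x w ih => simp [onWord, ih]

end InvAutomaton

/-! ### The Basilica group and its Schreier graphs

The letters `0` and `1` are `false` and `true`; the infinite word `x₁x₂x₃…` is the function
`ξ : ℕ → Bool` with `ξ n = x_{n+1}`. -/

/-- The states of the Basilica automaton. -/
inductive State
  | a
  | b
  | id

/-- The Basilica automaton: `a = e (b, id)` and `b = ε (a, id)`. -/
def basilica : InvAutomaton State Bool where
  trans
    | .a, false => .b
    | .a, true => .id
    | .b, false => .a
    | .b, true => .id
    | .id, _ => .id
  out
    | .a => 1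
    | .b => Equiv.boolNot
    | .id => 1

/-- Names for the two generators `a` and `b`. -/
inductive Gen
  | a
  | b

/-- The state of the automaton that defines a generator. -/
def Gen.state : Gen → State
  | .a => .a
  | .b => .b

/-- The generators of the Basilica group, acting on finite words. -/
def genWord (s : Gen) : Equiv.Perm (List Bool) := basilica.wordPerm s.state

/-- The generators of the Basilica group, acting on infinite words. -/
def genSeq (s : Gen) : Equiv.Perm (ℕ → Bool) := basilica.seqPerm s.state

/-- The Basilica group, as a group of transformations of the boundary of the binary tree. -/
def basilicaGroup : Subgroup (Equiv.Perm (ℕ → Bool)) :=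
  Subgroup.closure (Set.range genSeq)

/-- The (unlabelled) graph of the action of the generators `g i` on an invariant set `X`: for every
`x ∈ X` and every `i` there is one edge, joining `x` to `g i x`. The same edge, traversed backwards,
is the one that belongs to the inverse generator `(g i)⁻¹`. -/
def actionGraph {M ι : Type*} (g : ι → Equiv.Perm M) (X : Set M)
    (hX : ∀ i, ∀ x ∈ X, g i x ∈ X) : Graph M (M × ι) where
  vertexSet := X
  IsLink e y z := e.1 ∈ X ∧ s(y, z) = s(e.1, g e.2 e.1)
  isLink_symm := fun e _ => ⟨fun y z h => ⟨h.1, by rw [Sym2.eq_swap]; exact h.2⟩⟩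
  eq_or_eq_of_isLink_of_isLink := by
    rintro e x y v w ⟨-, h⟩ ⟨-, h'⟩
    have := h.trans h'.symm
    rw [Sym2.eq_iff] at this
    tauto
  left_mem_of_isLink := by
    rintro ⟨u, i⟩ x y ⟨hu, h⟩
    rw [Sym2.eq_iff] at h
    rcases h with ⟨rfl, -⟩ | ⟨rfl, -⟩
    · exact hu
    · exact hX i u hu

/-- The infinite orbital Schreier graph `Γ_ξ`: the graph of the action of `a` and `b` on the orbit
of `ξ` under the Basilica group. -/
def orbitalSchreierGraph (ξ : ℕ → Bool) : Graph (ℕ → Bool) ((ℕ → Bool) × Gen) :=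
  actionGraph genSeq (MulAction.orbit basilicaGroup ξ) (by
    rintro i x ⟨h, rfl⟩
    exact ⟨⟨genSeq i, Subgroup.subset_closure ⟨i, rfl⟩⟩ * h, mul_smul _ _ _⟩)

/-- The finite Schreier graph `Γ_n`: the graph of the action of `a` and `b` on the words of
length `n`. -/
def finiteSchreierGraph (n : ℕ) : Graph (List Bool) (List Bool × Gen) :=
  actionGraph genWord {w | w.length = n} (fun i w hw =>
    (basilica.length_onWord i.state w).trans hw)

/-! ### Decorations -/

/-- The word `0^k`. -/
def zeros (k : ℕ) : List Bool := List.replicate k false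

/-- The vertices of the decoration of `0^k` in `Γ_k` (`k ≥ 1`): the vertex `0^k` and all vertices of
`Γ_k ∖ {0^k}` that do not lie in the connected component of `0^{k-1}1`. -/
def decorationVerts (k : ℕ) : Set (List Bool) :=
  {w | w = zeros k ∨ (w.length = k ∧ w ≠ zeros k ∧
    ¬ SameComponent ((finiteSchreierGraph k).deleteVerts {zeros k})
      w (zeros (k - 1) ++ [true]))}

/-- The `k`-decoration (`k ≥ 1`): the decoration of the vertex `0^k` in `Γ_k`, that is, the subgraph
of `Γ_k` (loops included) induced by `decorationVerts k`. Its unique vertex of degree `2` is `0^k`;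
for `k = 1` it is a single vertex with a loop. -/
def decoration (k : ℕ) : Graph (List Bool) (List Bool × Gen) :=
  (finiteSchreierGraph k).induce (decorationVerts k)

/-! ### The line with decorations -/

/-- The vertex `w` of the copy of the `h`-decoration of type `k` attached at the integer `n`; its
root `0^h` is identified with the vertex `n` of the line. -/
def attachVertex (h : ℕ) (n : ℤ) (k : ℕ) (w : List Bool) : ℤ ⊕ (ℤ × ℕ × List Bool) :=
  if w = zeros h then Sum.inl n else Sum.inr (n, k, w)

/-- The straight line with integer vertices with, for every `k` and every `n ∈ A k`, a copy of the
`h k`-decoration attached by its root to the vertex `n`. -/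
def decoratedLine (A : ℕ → Set ℤ) (h : ℕ → ℕ) :
    Graph (ℤ ⊕ (ℤ × ℕ × List Bool)) (ℤ ⊕ (ℤ × ℕ × (List Bool × Gen))) where
  vertexSet := Set.range Sum.inl ∪
    {v | ∃ n k, n ∈ A k ∧ ∃ w ∈ (decoration (h k)).vertexSet, v = attachVertex (h k) n k w}
  IsLink
    | Sum.inl n, x, y => s(x, y) = s(Sum.inl n, Sum.inl (n + 1))
    | Sum.inr (n, k, e), x, y => n ∈ A k ∧ ∃ u v, (decoration (h k)).IsLink e u v ∧
        x = attachVertex (h k) n k u ∧ y = attachVertex (h k) n k v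
  isLink_symm := by
    rintro (n | ⟨n, k, e⟩) -
    · exact ⟨fun x y h => Eq.trans Sym2.eq_swap h⟩
    · exact ⟨fun x y ⟨hn, u, v, he, hx, hy⟩ => ⟨hn, v, u, he.symm, hy, hx⟩⟩
  eq_or_eq_of_isLink_of_isLink := by
    rintro (n | ⟨n, k, e⟩) x y v w H H'
    · have := Eq.trans H (Eq.symm H')
      rw [Sym2.eq_iff] at this
      tauto
    · obtain ⟨-, u₁, v₁, he₁, rfl, rfl⟩ := H
      obtain ⟨-, u₂, v₂, he₂, rfl, rfl⟩ := H'
      rcases he₁.left_eq_or_eq he₂ with rfl | rfl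
      · exact Or.inl rfl
      · exact Or.inr rfl
  left_mem_of_isLink := by
    rintro (n | ⟨n, k, e⟩) x y H
    · have H : s(x, y) = s(Sum.inl n, Sum.inl (n + 1)) := H
      rw [Sym2.eq_iff] at H
      rcases H with ⟨rfl, -⟩ | ⟨rfl, -⟩
      · exact Or.inl ⟨_, rfl⟩
      · exact Or.inl ⟨_, rfl⟩
    · obtain ⟨hn, u, v, he, rfl, rfl⟩ := H
      exact Or.inr ⟨n, k, hn, u, he.left_mem, rfl⟩

/-- The sets `A'_k` for the bits `y`, where `y i` stands for `β_{i+1}` (respectively `α_{i+1}`):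
`A'_k = {n | n ≡ 2^k - 1 - ∑_{i=1}^k 2^i β_{i+1} mod 2^(k+1)}`. For `k = 0` this is `2ℤ`. -/
def residueSet (y : ℕ → Bool) (k : ℕ) : Set ℤ :=
  {n | n ≡ 2 ^ k - 1 - ∑ i ∈ Finset.Icc 1 k, 2 ^ i * (if y i then 1 else 0) [ZMOD 2 ^ (k + 1)]}

theorem residueSet_zero (y : ℕ → Bool) : residueSet y 0 = {n | Even n} := by
  ext n
  simp [residueSet, Int.modEq_iff_dvd, even_iff_two_dvd]

/-! ### The sets `E_i` and the graphs `Γ(ξ)` -/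

/-- In `ξ = α₁β₁α₂β₂…`, the letter `α_{i+1}`. -/
def alphaBit (ξ : ℕ → Bool) (i : ℕ) : Bool := ξ (2 * i)

/-- In `ξ = α₁β₁α₂β₂…`, the letter `β_{i+1}`. -/
def betaBit (ξ : ℕ → Bool) (i : ℕ) : Bool := ξ (2 * i + 1)

/-- `E_i`: the infinite words `ξ` for which `Γ_ξ` has exactly `i` ends. -/
def endsClass (i : ℕ) : Set (ℕ → Bool) := {ξ | HasEnds (orbitalSchreierGraph ξ) i}

/-- `E_{2,even}`: the words `ξ ∈ E_2` for which only finitely many of the `α_i` are `1`. -/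
def E2Even : Set (ℕ → Bool) := {ξ ∈ endsClass 2 | {i | alphaBit ξ i = true}.Finite}

/-- `E_{2,odd}`: the words `ξ ∈ E_2` for which only finitely many of the `β_i` are `1`. -/
def E2Odd : Set (ℕ → Bool) := {ξ ∈ endsClass 2 | {i | betaBit ξ i = true}.Finite}

/-- `Γ(ξ)` for `ξ ∈ E_{2,even}`. -/
def evenGraph (ξ : ℕ → Bool) :=
  decoratedLine (residueSet (betaBit ξ)) (fun k => 2 * k + 2)

/-- `Γ(ξ)` for `ξ ∈ E_{2,odd}`. -/
def oddGraph (ξ : ℕ → Bool) :=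
  decoratedLine (residueSet (alphaBit ξ)) (fun k => 2 * k + 1)

end BasilicaSchreier

/-!
A generator reads a word from the left as long as it meets the letter `0`, and while doing so flips
the letters at the positions of one parity: the odd positions for `a`, the even ones for `b`
(`genSeq_apply`, positions counted from `0`). It stops after the first `1`. Everything below follows
from this description.

*Orbits.* A generator changes finitely many letters of every word but `000…`. With level
transitivity (`rel_zeroBelow`), every orbit is a cofinality class, except the orbit of `000…` (the
exceptional one), which is the union of the classes of `000…`, `0101…` and `1010…` (`mem_orbit_iff`).

*Cut vertices.* Away from `0ⁿ` the generators preserve the parity of the position of the last `1`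
among the first `n` letters (`LastOne.genSeq_of_ne_zero`). Hence `0ⁿ` separates the two parities in
`Γ_n`, and the decoration of `0ⁿ` consists of `0ⁿ` and of the words of one parity (`mem_decorationVerts_iff`);
the other parity class is a single component because the cycle of one generator through `0ⁿ` also
passes through `0ⁿ⁻¹1`.

*Ends.* After deletion of `000…` no edge of the exceptional orbit joins different cofinality
classes, and each of the three contains a ray; so there are at least three ends
(`not_hasEnds_two_of_exceptional`). If infinitely many letters at even positions and infinitely many
at odd positions are `1`, the orbit is exhausted by finite sets attached to their complement
at one vertex, and all rays are equivalent (`rayEquiv_of_infinite`). So for a word of `E_2` exactly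
one of the two parities carries only finitely many letters `1`.

*The line.* Let `s` be the generator that flips the other parity. On the words that vanish off the
positions of `s`, it acts as a binary odometer (`bitsVal_lineBits_genSeq_modEq`); those in the orbit
form one infinite orbit of `s`, the line (`exists_zpow_eq`). The integer `n` lies in `A'_k` exactly
when the `n`-th word of the line begins with `0^{h-1}1`, where `h` is the size of the decoration of
type `k` (`mem_residueSet_iff`). Replacing this block `0^{h-1}` by the first `h - 1` letters of a
vertex of the `h`-decoration reaches every vertex of the orbit exactly once (`exists_splice`,
`splice_injective`). This map respects the edges: the letter `1` that follows stops both generators,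
except for `s` at the root, which gives the edges of the line (`genSeq_splice`).
-/

namespace BasilicaSchreier

open Filter

/-! ### The generators in coordinates -/

/-- The parity of the positions at which a generator can change a letter: the odd ones for `a`, the
even ones for `b` (positions are counted from `0`). -/
def Gen.residue : Gen → ℕ
  | .a => 1
  | .b => 0

theorem Gen.residue_lt_two (s : Gen) : s.residue < 2 := by
  cases s <;> simp [Gen.residue]

theorem Gen.residue_injective : Function.Injective Gen.residue := by
  intro s t h
  cases s <;> cases t <;> simp_all [Gen.residue]

theorem stateAt_basilica (s : Gen) (x : ℕ → Bool) (j : ℕ) :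
    basilica.stateAt s.state x j =
      open Classical in if ∀ i < j, x i = false then
        (if j % 2 = s.residue then State.b else State.a) else State.id := by
  classical
  induction j with
  | zero => cases s <;> simp [InvAutomaton.stateAt, Gen.state, Gen.residue]
  | succ j ih =>
    rw [InvAutomaton.stateAt, ih]
    have hs := s.residue_lt_two
    have hsplit : (∀ i < j + 1, x i = false) ↔ (∀ i < j, x i = false) ∧ x j = false :=
      Nat.forall_lt_succ_right
    simp only [hsplit]
    by_cases h : ∀ i < j, x i = false
    · by_cases hj : j % 2 = s.residue
      · have hj' : ¬ (j + 1) % 2 = s.residue := by omega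
        rw [if_pos h, if_congr (and_iff_right h) rfl rfl]
        cases hx : x j <;> simp [hj, hj', basilica]
      · have hj' : (j + 1) % 2 = s.residue := by omega
        rw [if_pos h, if_congr (and_iff_right h) rfl rfl]
        cases hx : x j <;> simp [hj, hj', basilica]
    · rw [if_neg h, if_neg (fun h' => h h'.1)]
      cases x j <;> rfl

/-- A generator flips the letter at position `j` exactly when all earlier letters are `0` and `j`
has the parity of the generator. -/
theorem genSeq_apply (s : Gen) (x : ℕ → Bool) (j : ℕ) :
    genSeq s x j =
      open Classical in if (∀ i < j, x i = false) ∧ j % 2 = s.residue then !x j else x j := by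
  classical
  change basilica.out (basilica.stateAt s.state x j) (x j) = _
  rw [stateAt_basilica]
  by_cases h : ∀ i < j, x i = false
  · rw [if_pos h]
    by_cases hj : j % 2 = s.residue
    · rw [if_pos hj, if_pos ⟨h, hj⟩]
      rfl
    · rw [if_neg hj, if_neg (fun h' => hj h'.2)]
      rfl
  · rw [if_neg h, if_neg (fun h' => h h'.1)]
    rfl

theorem genSeq_of_flip {s : Gen} {x : ℕ → Bool} {j : ℕ} (h : ∀ i < j, x i = false)
    (hj : j % 2 = s.residue) : genSeq s x j = !x j := by
  rw [genSeq_apply, if_pos ⟨h, hj⟩]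

theorem genSeq_of_true_lt {s : Gen} {x : ℕ → Bool} {i j : ℕ} (hi : x i = true) (hij : i < j) :
    genSeq s x j = x j := by
  rw [genSeq_apply, if_neg]
  rintro ⟨h, -⟩
  simp [h i hij] at hi

theorem genSeq_of_residue_ne {s : Gen} {x : ℕ → Bool} {j : ℕ} (hj : j % 2 ≠ s.residue) :
    genSeq s x j = x j := by
  rw [genSeq_apply, if_neg (fun h => hj h.2)]

theorem flip_of_genSeq_ne {s : Gen} {x : ℕ → Bool} {j : ℕ} (h : genSeq s x j ≠ x j) :
    (∀ i < j, x i = false) ∧ j % 2 = s.residue := by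
  rw [genSeq_apply] at h
  by_contra h'
  rw [if_neg h'] at h
  exact h rfl

theorem genSeq_congr {s : Gen} {x y : ℕ → Bool} {j : ℕ} (h : ∀ i ≤ j, x i = y i) :
    genSeq s x j = genSeq s y j := by
  rw [genSeq_apply, genSeq_apply, h j le_rfl]
  congr 1
  have : (∀ i < j, x i = false) ↔ (∀ i < j, y i = false) :=
    forall₂_congr fun i hi => by rw [h i hi.le]
  rw [this]

/-- The word `000…`. -/
def zeroSeq : ℕ → Bool := fun _ => false

theorem genSeq_zeroSeq (s : Gen) (j : ℕ) :
    genSeq s zeroSeq j = decide (j % 2 = s.residue) := by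
  by_cases h : j % 2 = s.residue
  · rw [genSeq_of_flip (x := zeroSeq) (fun _ _ => rfl) h]; simp [zeroSeq, h]
  · rw [genSeq_of_residue_ne h]; simp [zeroSeq, h]

/-- Only on the word `000…` can a generator change infinitely many letters. -/
theorem genSeq_eventuallyEq {s : Gen} {x : ℕ → Bool} (hx : x ≠ zeroSeq) :
    genSeq s x =ᶠ[atTop] x := by
  obtain ⟨i, hi⟩ := Function.ne_iff.mp hx
  have hi : x i = true := by simpa [zeroSeq] using hi
  filter_upwards [eventually_gt_atTop i] with j hj using genSeq_of_true_lt hi hj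

/-! ### Finite words as prefixes -/

/-- The prefix of length `n` of an infinite word. -/
def wordPrefix (n : ℕ) (x : ℕ → Bool) : List Bool := List.ofFn fun i : Fin n => x i

theorem length_wordPrefix (n : ℕ) (x : ℕ → Bool) : (wordPrefix n x).length = n := by
  simp [wordPrefix]

theorem wordPrefix_eq_iff {n : ℕ} {x y : ℕ → Bool} :
    wordPrefix n x = wordPrefix n y ↔ ∀ j < n, x j = y j := by
  rw [wordPrefix, wordPrefix, List.ofFn_inj, funext_iff]
  exact ⟨fun h j hj => h ⟨j, hj⟩, fun h j => h j j.2⟩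

theorem getD_wordPrefix {n j : ℕ} (x : ℕ → Bool) (hj : j < n) :
    (wordPrefix n x).getD j false = x j := by
  simp [wordPrefix, List.getD, hj]

theorem exists_wordPrefix (w : List Bool) : ∃ x, w = wordPrefix w.length x :=
  ⟨fun j => w.getD j false, by
    apply List.ext_getElem
    · simp [wordPrefix]
    · intro i h₁ h₂
      simp [wordPrefix, List.getD]⟩

theorem zeros_eq_wordPrefix (n : ℕ) : zeros n = wordPrefix n zeroSeq := by
  apply List.ext_getElem <;> simp [zeros, wordPrefix, zeroSeq]

theorem wordPrefix_eq_zeros_iff {n : ℕ} {x : ℕ → Bool} :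
    wordPrefix n x = zeros n ↔ ∀ j < n, x j = false := by
  rw [zeros_eq_wordPrefix, wordPrefix_eq_iff]; rfl

theorem zeros_append_true (n : ℕ) :
    zeros n ++ [true] = wordPrefix (n + 1) (fun j => decide (j = n)) := by
  apply List.ext_getElem
  · simp [zeros, wordPrefix]
  · intro i h₁ h₂
    have hi : i < n + 1 := by simpa [zeros] using h₁
    rcases Nat.lt_succ_iff_lt_or_eq.mp hi with h | rfl
    · simp [zeros, wordPrefix, List.getElem_append_left, h, h.ne, -List.ofFn_succ]
    · simp [zeros, wordPrefix, -List.ofFn_succ]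

theorem InvAutomaton.stateAt_succ' {S X : Type*} (A : InvAutomaton S X) (s : S) (x : ℕ → X)
    (j : ℕ) : A.stateAt s x (j + 1) = A.stateAt (A.trans s (x 0)) (fun i => x (i + 1)) j := by
  induction j with
  | zero => rfl
  | succ j ih => rw [InvAutomaton.stateAt, ih]; rfl

theorem InvAutomaton.onWord_wordPrefix {S : Type*} (A : InvAutomaton S Bool) (s : S) (n : ℕ)
    (x : ℕ → Bool) : A.onWord s (wordPrefix n x) = wordPrefix n (A.onSeq s x) := by
  induction n generalizing s x with
  | zero => rfl
  | succ n ih =>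
    have hcons (y : ℕ → Bool) : wordPrefix (n + 1) y =
        y 0 :: wordPrefix n (fun i => y (i + 1)) := by
      simp [wordPrefix, List.ofFn_succ]
    rw [hcons, hcons, InvAutomaton.onWord, ih]
    congr 2
    funext j
    simp only [InvAutomaton.onSeq, InvAutomaton.stateAt_succ']

theorem genWord_wordPrefix (s : Gen) (n : ℕ) (x : ℕ → Bool) :
    genWord s (wordPrefix n x) = wordPrefix n (genSeq s x) :=
  basilica.onWord_wordPrefix s.state n x

/-! ### Erasing a prefix -/

/-- The word obtained from `x` by replacing the first `n` letters by `0`. -/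
def zeroBelow (n : ℕ) (x : ℕ → Bool) : ℕ → Bool := fun j => if j < n then false else x j

theorem zeroBelow_of_lt {n j : ℕ} (x : ℕ → Bool) (h : j < n) : zeroBelow n x j = false :=
  if_pos h

theorem zeroBelow_of_le {n j : ℕ} (x : ℕ → Bool) (h : n ≤ j) : zeroBelow n x j = x j :=
  if_neg (by omega)

/-- Level transitivity of the Basilica group: an equivalence relation that contains the graphs of
both generators identifies words with the same tail. The words `0ⁿ0…` and `0ⁿ1…` are related
because one of the two generators flips the letter after `0ⁿ`. -/
theorem rel_zeroBelow {R : (ℕ → Bool) → (ℕ → Bool) → Prop} (hR : Equivalence R)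
    (hgen : ∀ s x, R x (genSeq s x)) (n : ℕ) (x : ℕ → Bool) : R x (zeroBelow n x) := by
  induction n generalizing x with
  | zero =>
    have : zeroBelow 0 x = x := funext fun j => zeroBelow_of_le x (Nat.zero_le j)
    rw [this]; exact hR.refl x
  | succ n ih =>
    cases hx : x n with
    | false =>
      have : zeroBelow (n + 1) x = zeroBelow n x := by
        funext j
        rcases lt_trichotomy j n with h | rfl | h
        · rw [zeroBelow_of_lt _ h, zeroBelow_of_lt _ (by omega)]
        · rw [zeroBelow_of_lt _ (by omega), zeroBelow_of_le _ le_rfl, hx]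
        · rw [zeroBelow_of_le _ (by omega), zeroBelow_of_le _ (by omega)]
      rw [this]; exact ih x
    | true =>
      obtain ⟨s, hs⟩ : ∃ s : Gen, n % 2 = s.residue := by
        rcases Nat.mod_two_eq_zero_or_one n with h | h
        · exact ⟨.b, h⟩
        · exact ⟨.a, h⟩
      have hn : zeroBelow n x n = true := by rw [zeroBelow_of_le _ le_rfl, hx]
      have : zeroBelow (n + 1) x = zeroBelow n (genSeq s (zeroBelow n x)) := by
        funext j
        rcases lt_trichotomy j n with h | rfl | h
        · rw [zeroBelow_of_lt _ h, zeroBelow_of_lt _ (by omega)]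
        · rw [zeroBelow_of_lt _ (by omega), zeroBelow_of_le _ le_rfl,
            genSeq_of_flip (fun i hi => zeroBelow_of_lt x hi) hs, hn]
          rfl
        · rw [zeroBelow_of_le _ (by omega), zeroBelow_of_le _ h.le, genSeq_of_true_lt hn h,
            zeroBelow_of_le _ h.le]
      rw [this]
      exact hR.trans (hR.trans (ih x) (hgen s _)) (ih _)

theorem rel_of_eventuallyEq {R : (ℕ → Bool) → (ℕ → Bool) → Prop} (hR : Equivalence R)
    (hgen : ∀ s x, R x (genSeq s x)) {x y : ℕ → Bool} (h : x =ᶠ[atTop] y) : R x y := by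
  obtain ⟨n, hn⟩ := eventually_atTop.mp h
  have : zeroBelow n x = zeroBelow n y := by
    funext j
    rcases lt_or_ge j n with h | h
    · rw [zeroBelow_of_lt _ h, zeroBelow_of_lt _ h]
    · rw [zeroBelow_of_le _ h, zeroBelow_of_le _ h, hn j h]
  exact hR.trans (rel_zeroBelow hR hgen n x) (this ▸ hR.symm (rel_zeroBelow hR hgen n y))

/-! ### The parity of the last letter `1` -/

/-- Among the first `n` letters of `x` there is a `1`, and the last one is at a position of parity
`r`. -/
def LastOne (n r : ℕ) (x : ℕ → Bool) : Prop :=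
  ∃ p < n, p % 2 = r ∧ x p = true ∧ ∀ j, p < j → j < n → x j = false

theorem LastOne.ne_zero {n r : ℕ} {x : ℕ → Bool} (h : LastOne n r x) : ∃ j < n, x j = true :=
  let ⟨p, hp, _, h, _⟩ := h
  ⟨p, hp, h⟩

theorem exists_lastOne {n : ℕ} {x : ℕ → Bool} (h : ∃ j < n, x j = true) :
    ∃ r < 2, LastOne n r x := by
  classical
  obtain ⟨j, hj, hx⟩ := h
  have hP : ∃ m, m < n ∧ x (n - 1 - m) = true := ⟨n - 1 - j, by omega, by
    rwa [show n - 1 - (n - 1 - j) = j by omega]⟩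
  obtain ⟨hm, hxm⟩ := Nat.find_spec hP
  refine ⟨(n - 1 - Nat.find hP) % 2, Nat.mod_lt _ two_pos, n - 1 - Nat.find hP, by omega, rfl,
    hxm, fun i hi hin => ?_⟩
  have := Nat.find_min hP (m := n - 1 - i) (by omega)
  rw [show n - 1 - (n - 1 - i) = i by omega] at this
  simpa using fun h => this ⟨by omega, h⟩

theorem LastOne.unique {n r r' : ℕ} {x : ℕ → Bool} (h : LastOne n r x) (h' : LastOne n r' x) :
    r = r' := by
  obtain ⟨p, hp, rfl, hx, h⟩ := h
  obtain ⟨p', hp', rfl, hx', h'⟩ := h'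
  rcases lt_trichotomy p p' with hlt | rfl | hlt
  · simp [h p' hlt hp'] at hx'
  · rfl
  · simp [h' p hlt hp] at hx

theorem LastOne.congr {n r : ℕ} {x y : ℕ → Bool} (h : LastOne n r x)
    (hxy : ∀ j < n, x j = y j) : LastOne n r y := by
  obtain ⟨p, hp, hr, hx, h⟩ := h
  exact ⟨p, hp, hr, by rw [← hxy p hp, hx], fun j h₁ h₂ => by rw [← hxy j h₂, h j h₁ h₂]⟩

theorem lastOne_genSeq_of_zero {n : ℕ} {s : Gen} {x : ℕ → Bool} (hx : ∀ j < n, x j = false)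
    (h : ∃ j < n, genSeq s x j = true) : LastOne n s.residue (genSeq s x) := by
  obtain ⟨r, -, p, hp, hr, hxp, hlast⟩ := exists_lastOne h
  have := (flip_of_genSeq_ne (s := s) (x := x) (j := p) (by simp [hxp, hx p hp])).2
  exact ⟨p, hp, this, hxp, hlast⟩

theorem LastOne.eq_residue_of_genSeq_zero {n r : ℕ} {s : Gen} {x : ℕ → Bool} (h : LastOne n r x)
    (hx : ∀ j < n, genSeq s x j = false) : r = s.residue := by
  obtain ⟨p, hp, hr, hxp, -⟩ := h
  exact hr.symm.trans (flip_of_genSeq_ne (s := s) (x := x) (j := p) (by simp [hxp, hx p hp])).2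

/-- Away from `0ⁿ` the generators preserve the parity of the last `1`, so that `0ⁿ` separates the
two parities. -/
theorem LastOne.genSeq_of_ne_zero {n r : ℕ} {s : Gen} {x : ℕ → Bool} (h : LastOne n r x)
    (hne : ∃ j < n, genSeq s x j = true) : LastOne n r (genSeq s x) := by
  obtain ⟨p, hp, hr, hxp, hlast⟩ := h
  by_cases hfix : genSeq s x p = x p
  · exact ⟨p, hp, hr, hfix.trans hxp, fun j h₁ h₂ =>
      (genSeq_of_true_lt hxp h₁).trans (hlast j h₁ h₂)⟩
  · -- the only flipped `1` is the first letter `1`, and all flipped letters have the same parity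
    obtain ⟨hz, hps⟩ := flip_of_genSeq_ne hfix
    obtain ⟨r', -, p', hp', hr', hxp', hlast'⟩ := exists_lastOne hne
    have hp'p : genSeq s x p' ≠ x p' := by
      rcases lt_trichotomy p' p with hlt | rfl | hlt
      · simp [hxp', hz p' hlt]
      · exact hfix
      · rw [genSeq_of_true_lt hxp hlt, hlast p' hlt hp'] at hxp'
        simp at hxp'
    exact ⟨p', hp', by rw [(flip_of_genSeq_ne hp'p).2, ← hps, hr], hxp', hlast'⟩

theorem LastOne.of_genSeq {n r : ℕ} {s : Gen} {x : ℕ → Bool} (h : LastOne n r (genSeq s x))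
    (hne : ∃ j < n, x j = true) : LastOne n r x := by
  obtain ⟨r', -, hr'⟩ := exists_lastOne hne
  rwa [h.unique (hr'.genSeq_of_ne_zero h.ne_zero)]

/-! ### Binary expansions -/

/-- The integer `∑_{i<k} 2^i y_i` with the first `k` binary digits of `y`. -/
def bitsVal (y : ℕ → Bool) (k : ℕ) : ℤ :=
  ∑ i ∈ Finset.range k, 2 ^ i * (if y i then 1 else 0)

theorem bitsVal_succ (y : ℕ → Bool) (k : ℕ) :
    bitsVal y (k + 1) = bitsVal y k + 2 ^ k * (if y k then 1 else 0) :=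
  Finset.sum_range_succ _ _

theorem bitsVal_nonneg (y : ℕ → Bool) (k : ℕ) : 0 ≤ bitsVal y k :=
  Finset.sum_nonneg fun i _ => by positivity

theorem bitsVal_lt (y : ℕ → Bool) (k : ℕ) : bitsVal y k < 2 ^ k := by
  induction k with
  | zero => simp [bitsVal]
  | succ k ih =>
    rw [bitsVal_succ, pow_succ]
    split_ifs <;> linarith [pow_pos (two_pos : (0 : ℤ) < 2) k]

theorem bitsVal_congr {y z : ℕ → Bool} {k : ℕ} (h : ∀ i < k, y i = z i) :
    bitsVal y k = bitsVal z k :=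
  Finset.sum_congr rfl fun i hi => by rw [h i (Finset.mem_range.mp hi)]

theorem eq_of_bitsVal_eq {y z : ℕ → Bool} {k : ℕ} (h : bitsVal y k = bitsVal z k) :
    ∀ i < k, y i = z i := by
  induction k with
  | zero => simp
  | succ k ih =>
    rw [bitsVal_succ, bitsVal_succ] at h
    have h₁ := bitsVal_nonneg y k
    have h₂ := bitsVal_nonneg z k
    have h₃ := bitsVal_lt y k
    have h₄ := bitsVal_lt z k
    have hk : y k = z k := by
      cases hy : y k <;> cases hz : z k <;> simp [hy, hz] at h ⊢ <;> linarith
    rw [hk, add_left_inj] at h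
    exact Nat.forall_lt_succ_right.mpr ⟨ih h, hk⟩

theorem bitsVal_modEq_iff {y z : ℕ → Bool} {k : ℕ} :
    bitsVal y k ≡ bitsVal z k [ZMOD 2 ^ k] ↔ ∀ i < k, y i = z i := by
  refine ⟨fun h => eq_of_bitsVal_eq ?_, fun h => by rw [bitsVal_congr h]⟩
  rw [Int.ModEq, Int.emod_eq_of_lt (bitsVal_nonneg y k) (bitsVal_lt y k),
    Int.emod_eq_of_lt (bitsVal_nonneg z k) (bitsVal_lt z k)] at h
  exact h

theorem bitsVal_single (k : ℕ) : bitsVal (fun i => decide (i = k)) (k + 1) = 2 ^ k := by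
  rw [bitsVal_succ, bitsVal_congr (z := zeroSeq) fun i hi => by simp [zeroSeq, hi.ne]]
  simp [bitsVal, zeroSeq]

theorem bitsVal_zeroSeq (k : ℕ) : bitsVal zeroSeq k = 0 := by simp [bitsVal, zeroSeq]

/-! ### The line of a generator -/

/-- The letters of `x` at the positions that the generator `s` can change. -/
def lineBits (s : Gen) (x : ℕ → Bool) (i : ℕ) : Bool := x (2 * i + s.residue)

/-- All letters of `x` at the positions that `s` cannot change are `0`. On these words `s` acts as
an odometer, and the infinite orbits of `s` consist of such words. -/
def OnLine (s : Gen) (x : ℕ → Bool) : Prop := ∀ j, j % 2 ≠ s.residue → x j = false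

theorem onLine_zeroSeq (s : Gen) : OnLine s zeroSeq := fun _ _ => rfl

theorem onLine_genSeq_iff {s : Gen} {x : ℕ → Bool} : OnLine s (genSeq s x) ↔ OnLine s x :=
  forall₂_congr fun j hj => by rw [genSeq_of_residue_ne hj]

theorem OnLine.zpow {s : Gen} {x : ℕ → Bool} (h : OnLine s x) (n : ℤ) :
    OnLine s ((genSeq s ^ n) x) := by
  induction n using Int.induction_on with
  | zero => simpa using h
  | succ n ih =>
    rw [add_comm, zpow_add, zpow_one, Equiv.Perm.mul_apply, onLine_genSeq_iff]
    exact ih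
  | pred n ih =>
    rw [← onLine_genSeq_iff, ← Equiv.Perm.mul_apply, ← zpow_one_add]
    simpa using ih

theorem Gen.eq_two_mul_add (s : Gen) {j : ℕ} (h : j % 2 = s.residue) :
    j = 2 * (j / 2) + s.residue := by omega

theorem Gen.mod_two (s : Gen) (i : ℕ) : (2 * i + s.residue) % 2 = s.residue := by
  have := s.residue_lt_two; omega

theorem OnLine.zero_below_iff {s : Gen} {x : ℕ → Bool} (h : OnLine s x) (k : ℕ) :
    (∀ j < 2 * k + s.residue, x j = false) ↔ ∀ i < k, lineBits s x i = false := by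
  refine ⟨fun H i hi => H _ (by omega), fun H j hj => ?_⟩
  by_cases hjs : j % 2 = s.residue
  · rw [s.eq_two_mul_add hjs]
    exact H _ (by omega)
  · exact h j hjs

theorem OnLine.ext {s : Gen} {x y : ℕ → Bool} (hx : OnLine s x) (hy : OnLine s y)
    (h : ∀ i, lineBits s x i = lineBits s y i) : x = y := by
  funext j
  by_cases hjs : j % 2 = s.residue
  · rw [s.eq_two_mul_add hjs]
    exact h _
  · rw [hx j hjs, hy j hjs]

/-- The generator decrements the integer given by the first `k` bits, with a borrow if they are all
`0`. -/
theorem bitsVal_lineBits_genSeq {s : Gen} {x : ℕ → Bool} (h : OnLine s x) (k : ℕ) :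
    bitsVal (lineBits s (genSeq s x)) k = bitsVal (lineBits s x) k - 1 +
      open Classical in if ∀ i < k, lineBits s x i = false then 2 ^ k else 0 := by
  classical
  induction k with
  | zero => simp [bitsVal]
  | succ k ih =>
    rw [bitsVal_succ, bitsVal_succ, ih]
    by_cases hz : ∀ i < k, lineBits s x i = false
    · have hflip : lineBits s (genSeq s x) k = !lineBits s x k :=
        genSeq_of_flip ((h.zero_below_iff k).mpr hz) (s.mod_two k)
      rw [hflip, if_pos hz]
      cases hk : lineBits s x k with
      | false =>
        rw [if_pos (Nat.forall_lt_succ_right.mpr ⟨hz, hk⟩)]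
        simp [pow_succ]; ring
      | true =>
        have hz' : ¬ ∀ i < k + 1, lineBits s x i = false := fun H => by
          simp [H k (Nat.lt_succ_self k)] at hk
        rw [if_neg hz']
        simp; ring
    · have hfix : lineBits s (genSeq s x) k = lineBits s x k := by
        by_contra hne
        exact hz ((h.zero_below_iff k).mp (flip_of_genSeq_ne hne).1)
      have hz' : ¬ ∀ i < k + 1, lineBits s x i = false := fun H => hz fun i hi => H i (by omega)
      rw [hfix, if_neg hz, if_neg hz']
      ring

theorem bitsVal_lineBits_genSeq_modEq {s : Gen} {x : ℕ → Bool} (h : OnLine s x) (k : ℕ) :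
    bitsVal (lineBits s (genSeq s x)) k ≡ bitsVal (lineBits s x) k - 1 [ZMOD 2 ^ k] := by
  classical
  rw [bitsVal_lineBits_genSeq h]
  split_ifs <;> simp [Int.ModEq]

theorem bitsVal_lineBits_zpow_modEq {s : Gen} {x : ℕ → Bool} (h : OnLine s x) (n : ℤ) (k : ℕ) :
    bitsVal (lineBits s ((genSeq s ^ n) x)) k ≡ bitsVal (lineBits s x) k - n [ZMOD 2 ^ k] := by
  induction n using Int.induction_on with
  | zero => simp [Int.ModEq]
  | succ n ih =>
    have h₁ := bitsVal_lineBits_genSeq_modEq (h.zpow n) k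
    rw [← Equiv.Perm.mul_apply, ← zpow_one_add, add_comm] at h₁
    refine h₁.trans ?_
    rw [← sub_sub]
    exact ih.sub_right 1
  | pred n ih =>
    have h₁ := bitsVal_lineBits_genSeq_modEq (h.zpow (-n - 1)) k
    rw [← Equiv.Perm.mul_apply, ← zpow_one_add, add_sub_cancel] at h₁
    have h₂ := (h₁.symm.trans ih).add_right 1
    rw [sub_add_cancel] at h₂
    convert h₂ using 1
    ring

theorem zpow_genSeq_injective {s : Gen} {x : ℕ → Bool} (h : OnLine s x) :
    Function.Injective fun n : ℤ => (genSeq s ^ n) x := by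
  intro m n hmn
  have hmn : (genSeq s ^ m) x = (genSeq s ^ n) x := hmn
  have key (k : ℕ) : (2 : ℤ) ^ k ∣ m - n := by
    have h₁ := bitsVal_lineBits_zpow_modEq h m k
    rw [hmn] at h₁
    have h₂ := (h₁.symm.trans (bitsVal_lineBits_zpow_modEq h n k)).dvd
    convert h₂ using 1
    ring
  by_contra hne
  have hlt : |m - n| < 2 ^ (m - n).natAbs := by
    rw [Int.abs_eq_natAbs]
    exact_mod_cast Nat.lt_two_pow_self
  exact hne (sub_eq_zero.mp (Int.eq_zero_of_abs_lt_dvd (key _) hlt))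

/-- Two words of the line with the same tail lie in one orbit of the generator: the difference of
the integers given by long prefixes does not depend on their length. -/
theorem exists_zpow_eq {s : Gen} {x y : ℕ → Bool} (hx : OnLine s x) (hy : OnLine s y)
    (h : x =ᶠ[atTop] y) : ∃ n : ℤ, (genSeq s ^ n) x = y := by
  obtain ⟨N, hN⟩ := eventually_atTop.mp h
  have hdiff (k : ℕ) : bitsVal (lineBits s x) (N + k) - bitsVal (lineBits s y) (N + k) =
      bitsVal (lineBits s x) N - bitsVal (lineBits s y) N := by
    induction k with
    | zero => rfl
    | succ k ih =>
      rw [← add_assoc, bitsVal_succ, bitsVal_succ, ← ih]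
      have : lineBits s x (N + k) = lineBits s y (N + k) := hN _ (by omega)
      rw [this]
      ring
  refine ⟨bitsVal (lineBits s x) N - bitsVal (lineBits s y) N, (hx.zpow _).ext hy fun i => ?_⟩
  refine (bitsVal_modEq_iff (k := N + (i + 1))).mp ?_ i (by omega)
  refine (bitsVal_lineBits_zpow_modEq hx _ _).trans ?_
  rw [← hdiff (i + 1), sub_sub_cancel]

/-! ### Adjacency in the graph of an action -/

theorem actionGraph_adj_iff {M ι : Type*} {g : ι → Equiv.Perm M} {X : Set M}
    {hX : ∀ i, ∀ x ∈ X, g i x ∈ X} {x y : M} :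
    (actionGraph g X hX).Adj x y ↔
      ∃ i, (x ∈ X ∧ y = g i x) ∨ (y ∈ X ∧ x = g i y) := by
  constructor
  · rintro ⟨⟨u, i⟩, hu, h⟩
    rw [Sym2.eq_iff] at h
    rcases h with ⟨rfl, rfl⟩ | ⟨rfl, rfl⟩
    · exact ⟨i, Or.inl ⟨hu, rfl⟩⟩
    · exact ⟨i, Or.inr ⟨hu, rfl⟩⟩
  · rintro ⟨i, ⟨hx, rfl⟩ | ⟨hy, rfl⟩⟩
    · exact ⟨(x, i), hx, rfl⟩
    · exact ⟨(y, i), hy, Sym2.eq_swap⟩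

theorem deleteVerts_adj_iff {V E : Type*} {G : Graph V E} {S : Set V} {x y : V} :
    (G.deleteVerts S).Adj x y ↔ G.Adj x y ∧ x ∉ S ∧ y ∉ S := by
  simp only [Graph.Adj, Graph.deleteVerts_isLink]
  constructor
  · rintro ⟨e, h, hx, hy⟩; exact ⟨⟨e, h⟩, hx, hy⟩
  · rintro ⟨⟨e, h⟩, hx, hy⟩; exact ⟨e, h, hx, hy⟩

theorem SameComponent.of_adj {V E : Type*} {G : Graph V E} {x y : V} (h : G.Adj x y) :
    SameComponent G x y := ⟨h.left_mem, Relation.ReflTransGen.single h⟩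

theorem equivalence_reflTransGen_adj {V E : Type*} (G : Graph V E) :
    Equivalence (Relation.ReflTransGen G.Adj) where
  refl _ := Relation.ReflTransGen.refl
  symm h := by
    induction h with
    | refl => exact Relation.ReflTransGen.refl
    | tail _ h ih => exact Relation.ReflTransGen.head (Graph.Adj.symm h) ih
  trans := Relation.ReflTransGen.trans

/-! ### The decorations -/

theorem finiteSchreierGraph_adj_genSeq (n : ℕ) (s : Gen) (x : ℕ → Bool) :
    (finiteSchreierGraph n).Adj (wordPrefix n x) (wordPrefix n (genSeq s x)) :=
  actionGraph_adj_iff.mpr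
    ⟨s, Or.inl ⟨length_wordPrefix n x, (genWord_wordPrefix s n x).symm⟩⟩

theorem finiteSchreierGraph_connected (n : ℕ) (x y : ℕ → Bool) :
    Relation.ReflTransGen (finiteSchreierGraph n).Adj (wordPrefix n x) (wordPrefix n y) := by
  have hE := equivalence_reflTransGen_adj (finiteSchreierGraph n)
  have key (z : ℕ → Bool) : Relation.ReflTransGen (finiteSchreierGraph n).Adj (wordPrefix n z)
      (wordPrefix n (zeroBelow n z)) :=
    rel_zeroBelow (R := fun x y => Relation.ReflTransGen (finiteSchreierGraph n).Adj
      (wordPrefix n x) (wordPrefix n y)) (hE.comap _)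
      (fun s x => Relation.ReflTransGen.single (finiteSchreierGraph_adj_genSeq n s x)) n z
  have : wordPrefix n (zeroBelow n x) = wordPrefix n (zeroBelow n y) :=
    wordPrefix_eq_iff.mpr fun j hj => by rw [zeroBelow_of_lt _ hj, zeroBelow_of_lt _ hj]
  exact (key x).trans (this ▸ hE.symm (key y))

theorem wordPrefix_ne_zeros {n : ℕ} {x : ℕ → Bool} (h : wordPrefix n x ≠ zeros n) :
    ∃ j < n, x j = true := by
  simpa [wordPrefix_eq_zeros_iff] using h

theorem LastOne.wordPrefix_ne_zeros {n r : ℕ} {x : ℕ → Bool} (h : LastOne n r x) :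
    wordPrefix n x ≠ zeros n := by
  obtain ⟨j, hj, hx⟩ := h.ne_zero
  intro H
  simp [wordPrefix_eq_zeros_iff.mp H j hj] at hx

/-- Deleting `0ⁿ` from `Γ_n` separates the words according to the parity of the last `1`. -/
theorem lastOne_of_adj {n r : ℕ} {x : ℕ → Bool} {v : List Bool}
    (hadj : ((finiteSchreierGraph n).deleteVerts {zeros n}).Adj (wordPrefix n x) v)
    (h : LastOne n r x) : ∃ y, v = wordPrefix n y ∧ LastOne n r y := by
  obtain ⟨hadj, -, hv⟩ := deleteVerts_adj_iff.mp hadj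
  obtain ⟨s, ⟨-, rfl⟩ | ⟨hlen, hs⟩⟩ := actionGraph_adj_iff.mp hadj
  · rw [genWord_wordPrefix] at hv
    exact ⟨_, genWord_wordPrefix s n x, h.genSeq_of_ne_zero (wordPrefix_ne_zeros hv)⟩
  · obtain ⟨y, hy⟩ := exists_wordPrefix v
    rw [show v.length = n from hlen] at hy
    subst hy
    rw [genWord_wordPrefix, wordPrefix_eq_iff] at hs
    exact ⟨y, rfl, (h.congr hs).of_genSeq (wordPrefix_ne_zeros hv)⟩

theorem lastOne_of_sameComponent {n r : ℕ} {x y : ℕ → Bool}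
    (hxy : SameComponent ((finiteSchreierGraph n).deleteVerts {zeros n}) (wordPrefix n x)
      (wordPrefix n y))
    (h : LastOne n r x) : LastOne n r y := by
  obtain ⟨-, hxy⟩ := hxy
  have key : ∀ v, Relation.ReflTransGen ((finiteSchreierGraph n).deleteVerts {zeros n}).Adj
      (wordPrefix n x) v → ∃ y, v = wordPrefix n y ∧ LastOne n r y := by
    intro v hv
    induction hv with
    | refl => exact ⟨x, rfl, h⟩
    | tail _ hadj ih =>
      obtain ⟨y, rfl, hy⟩ := ih
      exact lastOne_of_adj hadj hy
  obtain ⟨z, hz, hlast⟩ := key _ hxy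
  exact hlast.congr fun j hj => (wordPrefix_eq_iff.mp hz j hj).symm

theorem wordPrefix_pow_genSeq_eq_iff {s : Gen} {y : ℕ → Bool} (hy : OnLine s y) (k i : ℕ) :
    wordPrefix (2 * k + s.residue + 1) ((genSeq s ^ i) zeroSeq) =
        wordPrefix (2 * k + s.residue + 1) y ↔
      -(i : ℤ) ≡ bitsVal (lineBits s y) (k + 1) [ZMOD 2 ^ (k + 1)] := by
  have hx := (onLine_zeroSeq s).zpow i
  have h := bitsVal_lineBits_zpow_modEq (onLine_zeroSeq s) i (k + 1)
  rw [zpow_natCast] at h hx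
  have hzero : bitsVal (lineBits s zeroSeq) (k + 1) = 0 := bitsVal_zeroSeq _
  rw [hzero, zero_sub] at h
  rw [wordPrefix_eq_iff]
  constructor
  · intro H
    exact h.symm.trans (bitsVal_modEq_iff.mpr fun i hi => H _ (by omega))
  · intro H j hj
    by_cases hjs : j % 2 = s.residue
    · rw [s.eq_two_mul_add hjs]
      exact bitsVal_modEq_iff.mp (h.trans H) _ (by omega)
    · rw [hx j hjs, hy j hjs]

theorem onLine_single (s : Gen) (k : ℕ) :
    OnLine s fun j => decide (j = 2 * k + s.residue) := by
  intro j hj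
  have := s.mod_two k
  simp only [decide_eq_false_iff_not]
  rintro rfl
  exact hj this

/-- Both neighbours of `0^N` on the `s`-cycle are joined to `0^{N-1}1` by an arc of that cycle which
avoids `0^N`. -/
theorem sameComponent_of_cycle (s : Gen) (k : ℕ) {x : ℕ → Bool}
    (h : wordPrefix (2 * k + s.residue + 1) x =
        wordPrefix (2 * k + s.residue + 1) (genSeq s zeroSeq) ∨
      wordPrefix (2 * k + s.residue + 1) (genSeq s x) = zeros (2 * k + s.residue + 1)) :
    SameComponent ((finiteSchreierGraph (2 * k + s.residue + 1)).deleteVerts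
        {zeros (2 * k + s.residue + 1)})
      (wordPrefix (2 * k + s.residue + 1) x) (zeros (2 * k + s.residue) ++ [true]) := by
  set N := 2 * k + s.residue + 1 with hN
  have hpow : (1 : ℕ) ≤ 2 ^ k := Nat.one_le_two_pow
  -- the points `s^i (0^N)` with `0 < i < 2^(k+1)` are different from `0^N`
  have hne (i : ℕ) (h₁ : 1 ≤ i) (h₂ : i < 2 ^ (k + 1)) :
      wordPrefix N ((genSeq s ^ i) zeroSeq) ≠ zeros N := by
    rw [zeros_eq_wordPrefix, Ne, wordPrefix_pow_genSeq_eq_iff (onLine_zeroSeq s)]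
    have hzero : bitsVal (lineBits s zeroSeq) (k + 1) = 0 := bitsVal_zeroSeq _
    rw [hzero, Int.modEq_zero_iff_dvd, dvd_neg]
    intro hdvd
    have := Nat.le_of_dvd h₁ (by exact_mod_cast hdvd : 2 ^ (k + 1) ∣ i)
    omega
  have harc (i : ℕ) (h₁ : 1 ≤ i) : i < 2 ^ (k + 1) →
      SameComponent ((finiteSchreierGraph N).deleteVerts {zeros N})
        (wordPrefix N ((genSeq s ^ 1) zeroSeq)) (wordPrefix N ((genSeq s ^ i) zeroSeq)) := by
    induction i, h₁ using Nat.le_induction with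
    | base =>
      intro h₂
      refine ⟨?_, Relation.ReflTransGen.refl⟩
      rw [Graph.vertexSet_deleteVerts]
      exact ⟨length_wordPrefix _ _, hne 1 le_rfl h₂⟩
    | succ i h₁ ih =>
      intro h₂
      refine (ih (by omega)).trans (SameComponent.of_adj (deleteVerts_adj_iff.mpr ⟨?_,
        hne i h₁ (by omega), hne (i + 1) (by omega) h₂⟩))
      rw [pow_succ', Equiv.Perm.mul_apply]
      exact finiteSchreierGraph_adj_genSeq N s _
  have hmid : zeros (2 * k + s.residue) ++ [true] =
      wordPrefix N ((genSeq s ^ (2 ^ k)) zeroSeq) := by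
    rw [zeros_append_true, eq_comm, wordPrefix_pow_genSeq_eq_iff (onLine_single s k)]
    rw [bitsVal_congr (z := fun i => decide (i = k)) (fun i _ => by simp [lineBits]),
      bitsVal_single]
    rw [Int.modEq_iff_dvd]
    push_cast
    exact ⟨1, by ring⟩
  obtain ⟨i, h₁, h₂, hi⟩ : ∃ i, 1 ≤ i ∧ i < 2 ^ (k + 1) ∧
      wordPrefix N x = wordPrefix N ((genSeq s ^ i) zeroSeq) := by
    rcases h with h | h
    · refine ⟨1, le_rfl, ?_, h⟩
      rw [pow_succ]; omega
    · refine ⟨2 ^ (k + 1) - 1, ?_, ?_, (genWord s).injective ?_⟩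
      · rw [pow_succ]; omega
      · rw [pow_succ]; omega
      · rw [genWord_wordPrefix, genWord_wordPrefix, h, ← Equiv.Perm.mul_apply, ← pow_succ',
          Nat.sub_add_cancel Nat.one_le_two_pow, zeros_eq_wordPrefix, eq_comm,
          wordPrefix_pow_genSeq_eq_iff (onLine_zeroSeq s)]
        have hzero : bitsVal (lineBits s zeroSeq) (k + 1) = 0 := bitsVal_zeroSeq _
        rw [hzero, Int.modEq_zero_iff_dvd, dvd_neg]
        push_cast
        exact dvd_rfl
  rw [hi, hmid]
  exact (harc i h₁ h₂).symm.trans (harc _ hpow (by rw [pow_succ]; omega))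

theorem sameComponent_of_lastOne (s : Gen) (k : ℕ) {x : ℕ → Bool}
    (hx : LastOne (2 * k + s.residue + 1) s.residue x) :
    SameComponent ((finiteSchreierGraph (2 * k + s.residue + 1)).deleteVerts
        {zeros (2 * k + s.residue + 1)})
      (wordPrefix (2 * k + s.residue + 1) x) (zeros (2 * k + s.residue) ++ [true]) := by
  have hcycle := @sameComponent_of_cycle s k
  set N := 2 * k + s.residue + 1 with hN
  have hpath := finiteSchreierGraph_connected N x zeroSeq
  rw [← zeros_eq_wordPrefix] at hpath
  have key : ∀ v, Relation.ReflTransGen (finiteSchreierGraph N).Adj v (zeros N) →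
      ∀ x, v = wordPrefix N x → LastOne N s.residue x →
      SameComponent ((finiteSchreierGraph N).deleteVerts {zeros N}) v
        (zeros (2 * k + s.residue) ++ [true]) := by
    intro v hv
    induction hv using Relation.ReflTransGen.head_induction_on with
    | refl =>
      intro x hx hlast
      exact absurd hx.symm hlast.wordPrefix_ne_zeros
    | @head v w hadj _ ih =>
      rintro x rfl hlast
      by_cases hw : w = zeros N
      · subst hw
        -- the path enters `0^N` through one of its two neighbours on the `s`-cycle
        obtain ⟨t, ⟨-, ht⟩ | ⟨-, ht⟩⟩ := actionGraph_adj_iff.mp hadj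
        · rw [genWord_wordPrefix] at ht
          have := hlast.eq_residue_of_genSeq_zero (wordPrefix_eq_zeros_iff.mp ht.symm)
          rw [← Gen.residue_injective this] at ht
          exact hcycle (Or.inr ht.symm)
        · rw [zeros_eq_wordPrefix, genWord_wordPrefix] at ht
          have h₁ := hlast.congr (wordPrefix_eq_iff.mp ht)
          have := h₁.unique (lastOne_genSeq_of_zero (fun _ _ => rfl) h₁.ne_zero)
          rw [← Gen.residue_injective this] at ht
          exact hcycle (Or.inl ht)
      · have hadj' : ((finiteSchreierGraph N).deleteVerts {zeros N}).Adj (wordPrefix N x) w :=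
          deleteVerts_adj_iff.mpr ⟨hadj, hlast.wordPrefix_ne_zeros, hw⟩
        obtain ⟨y, hy, hylast⟩ := lastOne_of_adj hadj' hlast
        exact (SameComponent.of_adj hadj').trans (ih y hy hylast)
  exact key _ hpath x rfl hx

/-- The decoration of `0^N` consists of `0^N` and of the words whose last `1` is at a position of
the parity of `N`, that is, not of the parity of the generator `s` whose cycle through `0^N`
contains `0^{N-1}1`. -/
theorem mem_decorationVerts_iff (s : Gen) (k : ℕ) {x : ℕ → Bool} :
    wordPrefix (2 * k + s.residue + 1) x ∈ decorationVerts (2 * k + s.residue + 1) ↔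
      (∀ j < 2 * k + s.residue + 1, x j = false) ∨
        LastOne (2 * k + s.residue + 1) (1 - s.residue) x := by
  have hs := s.residue_lt_two
  rw [decorationVerts, Set.mem_ofPred_eq, wordPrefix_eq_zeros_iff]
  refine or_congr_right' fun hne => ?_
  rw [Nat.add_sub_cancel]
  constructor
  · rintro ⟨-, -, hcomp⟩
    obtain ⟨r, hr, hlast⟩ :=
      exists_lastOne (n := 2 * k + s.residue + 1) (x := x) (by simpa using hne)
    have hrs : r ≠ s.residue := by
      rintro rfl
      exact hcomp (sameComponent_of_lastOne s k hlast)
    rwa [show 1 - s.residue = r by omega]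
  · intro hlast
    -- a path to `0^{N-1}1` would preserve the parity of the last `1`
    refine ⟨length_wordPrefix _ _, hlast.wordPrefix_ne_zeros, fun hcomp => ?_⟩
    rw [zeros_append_true] at hcomp
    have h₁ := lastOne_of_sameComponent hcomp hlast
    have h₂ : LastOne (2 * k + s.residue + 1) s.residue
        (fun j => decide (j = 2 * k + s.residue)) :=
      ⟨2 * k + s.residue, by omega, s.mod_two k, by simp, fun j h₁ h₂ => by omega⟩
    have := h₁.unique h₂
    omega

/-! ### Orbits of the Basilica group -/

/-- The words with the same tail as `000…`, `0101…` or `1010…`. They form the orbit of `000…`, which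
is the only orbit that is not a single cofinality class. -/
def Exceptional (x : ℕ → Bool) : Prop :=
  x =ᶠ[atTop] zeroSeq ∨ ∃ s, x =ᶠ[atTop] genSeq s zeroSeq

theorem Exceptional.congr {x y : ℕ → Bool} (h : Exceptional x) (hxy : x =ᶠ[atTop] y) :
    Exceptional y := by
  rcases h with h | ⟨s, h⟩
  · exact Or.inl (hxy.symm.trans h)
  · exact Or.inr ⟨s, hxy.symm.trans h⟩

theorem genSeq_mem_basilicaGroup (s : Gen) : genSeq s ∈ basilicaGroup :=
  Subgroup.subset_closure ⟨s, rfl⟩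

theorem zpow_genSeq_mem_orbit {ξ x : ℕ → Bool} (hx : x ∈ MulAction.orbit basilicaGroup ξ)
    (s : Gen) (n : ℤ) : (genSeq s ^ n) x ∈ MulAction.orbit basilicaGroup ξ := by
  obtain ⟨h, rfl⟩ := hx
  exact ⟨⟨genSeq s ^ n, zpow_mem (genSeq_mem_basilicaGroup s) n⟩ * h, mul_smul _ _ _⟩

theorem genSeq_mem_orbit_iff {ξ x : ℕ → Bool} (s : Gen) :
    genSeq s x ∈ MulAction.orbit basilicaGroup ξ ↔ x ∈ MulAction.orbit basilicaGroup ξ := by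
  constructor
  · intro h
    have := zpow_genSeq_mem_orbit h s (-1)
    rwa [← Equiv.Perm.mul_apply, zpow_neg_one, inv_mul_cancel] at this
  · intro h
    simpa using zpow_genSeq_mem_orbit h s 1

theorem mem_orbit_of_eventuallyEq {ξ x : ℕ → Bool} (h : x =ᶠ[atTop] ξ) :
    x ∈ MulAction.orbit basilicaGroup ξ := by
  have hR : Equivalence fun x y : ℕ → Bool =>
      (x ∈ MulAction.orbit basilicaGroup ξ ↔ y ∈ MulAction.orbit basilicaGroup ξ) :=
    ⟨fun _ => Iff.rfl, Iff.symm, Iff.trans⟩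
  exact (rel_of_eventuallyEq hR (fun s x => (genSeq_mem_orbit_iff s).symm) h).mpr
    (MulAction.mem_orbit_self ξ)

theorem eventuallyEq_of_mem_orbit {ξ x : ℕ → Bool} (hξ : ¬ Exceptional ξ)
    (hx : x ∈ MulAction.orbit basilicaGroup ξ) : x =ᶠ[atTop] ξ := by
  have key : ∀ g ∈ basilicaGroup, ∀ y : ℕ → Bool, g y =ᶠ[atTop] ξ ↔ y =ᶠ[atTop] ξ := by
    intro g hg
    induction hg using Subgroup.closure_induction with
    | mem g hg =>
      obtain ⟨s, rfl⟩ := hg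
      intro y
      by_cases hy : y = zeroSeq
      · subst hy
        exact ⟨fun h => absurd (Or.inr ⟨s, h.symm⟩) hξ, fun h => absurd (Or.inl h.symm) hξ⟩
      · have := genSeq_eventuallyEq (s := s) hy
        exact ⟨this.symm.trans, this.trans⟩
    | one => exact fun y => Iff.rfl
    | mul g h _ _ hg hh => exact fun y => (hg (h y)).trans (hh y)
    | inv g _ hg =>
      intro y
      rw [← hg (g⁻¹ y), ← Equiv.Perm.mul_apply, mul_inv_cancel]
      rfl
  obtain ⟨⟨g, hg⟩, rfl⟩ := hx
  exact (key g hg ξ).mpr EventuallyEq.rfl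

theorem mem_orbit_iff {ξ x : ℕ → Bool} (hξ : ¬ Exceptional ξ) :
    x ∈ MulAction.orbit basilicaGroup ξ ↔ x =ᶠ[atTop] ξ :=
  ⟨eventuallyEq_of_mem_orbit hξ, mem_orbit_of_eventuallyEq⟩

theorem zeroSeq_mem_orbit {ξ : ℕ → Bool} (hξ : Exceptional ξ) :
    zeroSeq ∈ MulAction.orbit basilicaGroup ξ := by
  rcases hξ with h | ⟨s, h⟩
  · exact mem_orbit_of_eventuallyEq h.symm
  · exact (genSeq_mem_orbit_iff s).mp (mem_orbit_of_eventuallyEq h.symm)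

theorem orbitalSchreierGraph_adj_iff {ξ x y : ℕ → Bool} :
    (orbitalSchreierGraph ξ).Adj x y ↔ x ∈ MulAction.orbit basilicaGroup ξ ∧
      ∃ s, y = genSeq s x ∨ x = genSeq s y := by
  refine actionGraph_adj_iff.trans ⟨?_, ?_⟩
  · rintro ⟨s, ⟨hx, rfl⟩ | ⟨hy, rfl⟩⟩
    · exact ⟨hx, s, Or.inl rfl⟩
    · exact ⟨(genSeq_mem_orbit_iff s).mpr hy, s, Or.inr rfl⟩
  · rintro ⟨hx, s, rfl | rfl⟩
    · exact ⟨s, Or.inl ⟨hx, rfl⟩⟩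
    · exact ⟨s, Or.inr ⟨(genSeq_mem_orbit_iff s).mp hx, rfl⟩⟩

theorem orbitalSchreierGraph_reachable {ξ x y : ℕ → Bool}
    (hx : x ∈ MulAction.orbit basilicaGroup ξ) (h : x =ᶠ[atTop] y) :
    Relation.ReflTransGen (orbitalSchreierGraph ξ).Adj x y := by
  have hE := equivalence_reflTransGen_adj (orbitalSchreierGraph ξ)
  have hR : Equivalence fun x y : ℕ → Bool =>
      (x ∈ MulAction.orbit basilicaGroup ξ ↔ y ∈ MulAction.orbit basilicaGroup ξ) ∧
        (x ∈ MulAction.orbit basilicaGroup ξ →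
          Relation.ReflTransGen (orbitalSchreierGraph ξ).Adj x y) :=
    ⟨fun x => ⟨Iff.rfl, fun _ => hE.refl x⟩,
      fun h => ⟨h.1.symm, fun hy => hE.symm (h.2 (h.1.mpr hy))⟩,
      fun h h' => ⟨h.1.trans h'.1, fun hx => (h.2 hx).trans (h'.2 (h.1.mp hx))⟩⟩
  exact (rel_of_eventuallyEq hR (fun s x => ⟨(genSeq_mem_orbit_iff s).symm, fun hx =>
    Relation.ReflTransGen.single (orbitalSchreierGraph_adj_iff.mpr ⟨hx, s, Or.inl rfl⟩)⟩) h).2 hx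

/-! ### The exceptional orbit has more than two ends -/

theorem eventuallyEq_of_sameComponent {ξ x y : ℕ → Bool}
    (h : SameComponent ((orbitalSchreierGraph ξ).deleteVerts {zeroSeq}) x y) :
    x =ᶠ[atTop] y := by
  obtain ⟨-, h⟩ := h
  induction h with
  | refl => exact EventuallyEq.rfl
  | tail _ hadj ih =>
    obtain ⟨hadj, hy, hz⟩ := deleteVerts_adj_iff.mp hadj
    obtain ⟨-, s, rfl | rfl⟩ := orbitalSchreierGraph_adj_iff.mp hadj
    · exact ih.trans (genSeq_eventuallyEq hy).symm
    · exact ih.trans (genSeq_eventuallyEq hz)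

theorem zpow_genSeq_zeroSeq_ne (s : Gen) {n : ℤ} (hn : n ≠ 0) :
    (genSeq s ^ n) zeroSeq ≠ zeroSeq := fun h =>
  hn (zpow_genSeq_injective (onLine_zeroSeq s) (a₂ := 0) (by simpa using h))

theorem genSeq_zpow_apply (s : Gen) (n : ℤ) (x : ℕ → Bool) :
    genSeq s ((genSeq s ^ n) x) = (genSeq s ^ (n + 1)) x := by
  rw [← Equiv.Perm.mul_apply, ← zpow_one_add, add_comm]

theorem zpow_genSeq_zeroSeq_eventuallyEq (s : Gen) (n : ℕ) :
    (genSeq s ^ (n + 1 : ℤ)) zeroSeq =ᶠ[atTop] genSeq s zeroSeq := by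
  induction n with
  | zero => simp
  | succ n ih =>
    push_cast
    rw [← genSeq_zpow_apply]
    exact (genSeq_eventuallyEq (zpow_genSeq_zeroSeq_ne s (by omega))).trans ih

theorem zpow_neg_genSeq_zeroSeq_eventuallyEq (s : Gen) (n : ℕ) :
    (genSeq s ^ (-n : ℤ)) zeroSeq =ᶠ[atTop] zeroSeq := by
  induction n with
  | zero => simp
  | succ n ih =>
    have h := genSeq_eventuallyEq (s := s)
      (zpow_genSeq_zeroSeq_ne s (n := -((n + 1 : ℕ) : ℤ)) (by omega))
    rw [genSeq_zpow_apply, show -((n + 1 : ℕ) : ℤ) + 1 = -n by push_cast; ring] at h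
    exact h.symm.trans ih

theorem not_zeroSeq_eventuallyEq (s : Gen) : ¬ zeroSeq =ᶠ[atTop] genSeq s zeroSeq := by
  intro h
  obtain ⟨N, hN⟩ := eventually_atTop.mp h
  have := hN (2 * N + s.residue) (by omega)
  rw [genSeq_zeroSeq, s.mod_two] at this
  simp [zeroSeq] at this

theorem not_genSeq_zeroSeq_eventuallyEq :
    ¬ genSeq .a zeroSeq =ᶠ[atTop] genSeq .b zeroSeq := by
  intro h
  obtain ⟨N, hN⟩ := eventually_atTop.mp h
  have := hN (2 * N) (by omega)
  simp [genSeq_zeroSeq, Gen.residue] at this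

/-- The ray `n ↦ s^{ε (n+1)} (000…)` of an exceptional orbit, for a sign `ε`. -/
def zeroRay {ξ : ℕ → Bool} (hξ : Exceptional ξ) (s : Gen) (ε : ℤˣ) :
    Ray (orbitalSchreierGraph ξ) where
  vertex n := (genSeq s ^ ((ε : ℤ) * (n + 1))) zeroSeq
  injective m n h := by
    have := zpow_genSeq_injective (onLine_zeroSeq s) h
    have := mul_left_cancel₀ ε.ne_zero this
    omega
  adj n := by
    refine orbitalSchreierGraph_adj_iff.mpr
      ⟨zpow_genSeq_mem_orbit (zeroSeq_mem_orbit hξ) s _, s, ?_⟩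
    rcases Int.units_eq_one_or ε with rfl | rfl
    · left
      rw [genSeq_zpow_apply]
      congr 2
    · right
      rw [genSeq_zpow_apply]
      congr 2

/-- Deleting `000…` leaves the three rays in different cofinality classes, and no edge of the
remaining graph joins different classes. -/
theorem not_hasEnds_two_of_exceptional {ξ : ℕ → Bool} (hξ : Exceptional ξ) :
    ¬ HasEnds (orbitalSchreierGraph ξ) 2 := by
  rintro ⟨f⟩
  have htail {r r' : Ray (orbitalSchreierGraph ξ)} (h : RayEquiv r r') :
      ∃ n, r.vertex n =ᶠ[atTop] r'.vertex n := by
    obtain ⟨N, hN⟩ := h {zeroSeq} (Set.finite_singleton _)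
    exact ⟨N, eventuallyEq_of_sameComponent (hN N le_rfl N le_rfl)⟩
  have hpos (s : Gen) (n : ℕ) : (zeroRay hξ s 1).vertex n =ᶠ[atTop] genSeq s zeroSeq := by
    simpa [zeroRay] using zpow_genSeq_zeroSeq_eventuallyEq s n
  have hneg (n : ℕ) : (zeroRay hξ .a (-1)).vertex n =ᶠ[atTop] zeroSeq := by
    have h := zpow_neg_genSeq_zeroSeq_eventuallyEq .a (n + 1)
    have hv : (zeroRay hξ .a (-1)).vertex n = (genSeq .a ^ (-((n + 1 : ℕ) : ℤ))) zeroSeq := by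
      simp [zeroRay]
    rwa [hv]
  have h₁ : ¬ RayEquiv (zeroRay hξ .a 1) (zeroRay hξ .b 1) := fun h => by
    obtain ⟨n, hn⟩ := htail h
    exact not_genSeq_zeroSeq_eventuallyEq ((hpos .a n).symm.trans (hn.trans (hpos .b n)))
  have h₂ (s : Gen) : ¬ RayEquiv (zeroRay hξ .a (-1)) (zeroRay hξ s 1) := fun h => by
    obtain ⟨n, hn⟩ := htail h
    exact not_zeroSeq_eventuallyEq s ((hneg n).symm.trans (hn.trans (hpos s n)))
  have hne {r r' : Ray (orbitalSchreierGraph ξ)} (h : ¬ RayEquiv r r') :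
      f (Quotient.mk (raySetoid _) r) ≠ f (Quotient.mk (raySetoid _) r') := fun H =>
    h (Quotient.exact (s := raySetoid _) (f.injective H))
  have e₁ := hne h₁
  have e₂ := hne (h₂ .a)
  have e₃ := hne (h₂ .b)
  omega

/-! ### Infinitely many ones of both parities: a single end -/

/-- Arbitrarily far there is a `1` at an even position such that the next `1` is at an odd
position. -/
theorem exists_parity_switch {ξ : ℕ → Bool} (h₀ : {i | alphaBit ξ i = true}.Infinite)
    (h₁ : {i | betaBit ξ i = true}.Infinite) (m : ℕ) :
    ∃ n p, m ≤ p ∧ p < n ∧ p % 2 = 0 ∧ n % 2 = 1 ∧ ξ p = true ∧ ξ n = true ∧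
      ∀ j, p < j → j < n → ξ j = false := by
  obtain ⟨i, hi, him⟩ := h₀.exists_gt m
  have hi : ξ (2 * i) = true := hi
  have hP : ∃ o, 2 * i < o ∧ o % 2 = 1 ∧ ξ o = true := by
    obtain ⟨k, hk, hki⟩ := h₁.exists_gt i
    exact ⟨2 * k + 1, by omega, by omega, hk⟩
  obtain ⟨hlt, hodd, ho⟩ := Nat.find_spec hP
  obtain ⟨r, -, p, hp, -, hxp, hlast⟩ := exists_lastOne (n := Nat.find hP) ⟨_, hlt, hi⟩
  have hip : 2 * i ≤ p := by
    by_contra! H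
    simp [hlast _ H hlt] at hi
  refine ⟨Nat.find hP, p, by omega, hp, ?_, hodd, hxp, ho, hlast⟩
  by_contra hpar
  exact Nat.find_min hP hp ⟨by omega, by omega, hxp⟩

/-- If the letter of `ξ` at the odd position `n` is `1`, the words `x` with the tail of `ξ` from `n`
on and with their last `1` before `n` at an even position form a set whose only outer neighbour is
the word `0ⁿ1…`. -/
theorem decoration_boundary {ξ x y : ℕ → Bool} {n : ℕ} (hn : n % 2 = 1) (hξ : ξ n = true)
    (hx : ∀ j ≥ n, x j = ξ j) (hlast : LastOne n 0 x) {s : Gen}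
    (h : y = genSeq s x ∨ x = genSeq s y) :
    ((∀ j ≥ n, y j = ξ j) ∧ LastOne n 0 y) ∨ y = zeroBelow n ξ := by
  have hroot (hy : ∀ j ≥ n, y j = ξ j) (hz : ∀ j < n, y j = false) : y = zeroBelow n ξ := by
    funext j
    rcases lt_or_ge j n with h | h
    · rw [zeroBelow_of_lt _ h, hz j h]
    · rw [zeroBelow_of_le _ h, hy j h]
  rcases h with rfl | rfl
  · obtain ⟨i, hi, hxi⟩ := hlast.ne_zero
    have htail : ∀ j ≥ n, genSeq s x j = ξ j := fun j hj =>
      (genSeq_of_true_lt hxi (by omega)).trans (hx j hj)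
    by_cases hz : ∀ j < n, genSeq s x j = false
    · exact Or.inr (hroot htail hz)
    · exact Or.inl ⟨htail, hlast.genSeq_of_ne_zero (by simpa using hz)⟩
  · by_cases hz : ∀ j < n, y j = false
    · right
      have hs : s.residue = 0 := (lastOne_genSeq_of_zero hz hlast.ne_zero).unique hlast
      -- at position `n` nothing is flipped, and the `1` found there stops the generator
      have hyn : genSeq s y n = y n := genSeq_of_residue_ne (by omega)
      have hyn' : y n = true := by rw [← hyn, hx n le_rfl, hξ]
      refine hroot (fun j hj => ?_) hz
      rcases hj.eq_or_lt with rfl | hj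
      · rw [hyn', hξ]
      · rw [← hx j hj.le, genSeq_of_true_lt hyn' hj]
    · have hz : ∃ j < n, y j = true := by simpa using hz
      obtain ⟨i, hi, hyi⟩ := hz
      refine Or.inl ⟨fun j hj => ?_, hlast.of_genSeq ⟨i, hi, hyi⟩⟩
      rw [← hx j hj, genSeq_of_true_lt hyi (by omega)]

theorem finite_setOf_tail_eq (ξ : ℕ → Bool) (n : ℕ) :
    {x : ℕ → Bool | ∀ j ≥ n, x j = ξ j}.Finite := by
  refine Set.Finite.of_injOn (f := fun (x : ℕ → Bool) (i : Fin n) => x i) (t := Set.univ)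
    (fun _ _ => Set.mem_univ _) (fun x hx y hy h => ?_) Set.finite_univ
  funext j
  rcases lt_or_ge j n with hj | hj
  · exact congr_fun h ⟨j, hj⟩
  · exact (hx j hj).trans (hy j hj).symm

/-- The orbit is exhausted by finite sets, each attached to the rest of the graph at a single
vertex; so the complement of each of them is connected. -/
theorem rayEquiv_of_infinite {ξ : ℕ → Bool} (h₀ : {i | alphaBit ξ i = true}.Infinite)
    (h₁ : {i | betaBit ξ i = true}.Infinite) (hξ : ¬ Exceptional ξ)
    (r r' : Ray (orbitalSchreierGraph ξ)) : RayEquiv r r' := by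
  intro S hS
  have htail : ∀ x ∈ S ∩ MulAction.orbit basilicaGroup ξ, ∀ᶠ m in atTop, x m = ξ m :=
    fun x hx => eventuallyEq_of_mem_orbit hξ hx.2
  obtain ⟨m, hm⟩ := eventually_atTop.mp
    ((eventually_all_finite (hS.subset Set.inter_subset_left)).mpr htail)
  obtain ⟨n, p, hmp, hpn, hp, hn, hξp, hξn, hlast⟩ := exists_parity_switch h₀ h₁ m
  set D : Set (ℕ → Bool) := {x | (∀ j ≥ n, x j = ξ j) ∧ LastOne n 0 x} with hD
  have hDfin : D.Finite := (finite_setOf_tail_eq ξ n).subset fun x hx => hx.1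
  have hSD : ∀ x ∈ MulAction.orbit basilicaGroup ξ, x ∉ D → x ∉ S := by
    intro x hx hxD hxS
    have hxm : ∀ j ≥ m, x j = ξ j := fun j hj => hm j hj x ⟨hxS, hx⟩
    exact hxD ⟨fun j hj => hxm j (by omega), p, hpn, hp, by rw [hxm p hmp, hξp],
      fun j hj hjn => by rw [hxm j (by omega), hlast j hj hjn]⟩
  set v := zeroBelow n ξ with hv
  have hvD : v ∉ D := by
    rintro ⟨-, h⟩
    obtain ⟨j, hj, hvj⟩ := h.ne_zero
    rw [hv, zeroBelow_of_lt _ hj] at hvj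
    simp at hvj
  have hvξ : v =ᶠ[atTop] ξ := eventually_atTop.mpr ⟨n, fun j hj => zeroBelow_of_le ξ hj⟩
  have key : ∀ x ∈ MulAction.orbit basilicaGroup ξ, x ∉ D →
      SameComponent ((orbitalSchreierGraph ξ).deleteVerts S) x v := by
    intro x hx
    have hpath := orbitalSchreierGraph_reachable hx
      ((eventuallyEq_of_mem_orbit hξ hx).trans hvξ.symm)
    have hmem : ∀ y ∈ MulAction.orbit basilicaGroup ξ, y ∉ D →
        y ∈ ((orbitalSchreierGraph ξ).deleteVerts S).vertexSet := fun y hy hyD => by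
      rw [Graph.vertexSet_deleteVerts]
      exact ⟨hy, hSD y hy hyD⟩
    induction hpath using Relation.ReflTransGen.head_induction_on with
    | refl => exact fun hvD => ⟨hmem v hx hvD, Relation.ReflTransGen.refl⟩
    | @head y z hadj _ ih =>
      intro hyD
      have hz : z ∈ MulAction.orbit basilicaGroup ξ := hadj.right_mem
      by_cases hzD : z ∈ D
      · obtain ⟨-, s, hs⟩ := orbitalSchreierGraph_adj_iff.mp hadj
        have hyv : y = v :=
          (decoration_boundary hn hξn hzD.1 hzD.2 hs.symm).resolve_left hyD
        rw [← hyv]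
        exact ⟨hmem y hx hyD, Relation.ReflTransGen.refl⟩
      · exact (SameComponent.of_adj (deleteVerts_adj_iff.mpr
          ⟨hadj, hSD y hx hyD, hSD z hz hzD⟩)).trans (ih hz hzD)
  have hray (r : Ray (orbitalSchreierGraph ξ)) : ∀ᶠ k in atTop, r.vertex k ∉ D := by
    rw [← Nat.cofinite_eq_atTop]
    exact (hDfin.preimage r.injective.injOn).eventually_cofinite_notMem
  obtain ⟨N, hN⟩ := eventually_atTop.mp ((hray r).and (hray r'))
  exact ⟨N, fun i hi j hj => (key _ (r.adj i).left_mem (hN i hi).1).trans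
    (key _ (r'.adj j).left_mem (hN j hj).2).symm⟩

theorem not_exceptional_of_mem_endsClass {ξ : ℕ → Bool} (hξ : ξ ∈ endsClass 2) :
    ¬ Exceptional ξ := fun h => not_hasEnds_two_of_exceptional h hξ

theorem finite_or_finite_of_mem_endsClass {ξ : ℕ → Bool} (hξ : ξ ∈ endsClass 2) :
    {i | alphaBit ξ i = true}.Finite ∨ {i | betaBit ξ i = true}.Finite := by
  by_contra! H
  obtain ⟨f⟩ := hξ
  have hsub : f.symm 0 = f.symm 1 := by
    induction f.symm 0 using Quotient.inductionOn with | _ r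
    induction f.symm 1 using Quotient.inductionOn with | _ r'
    exact Quotient.sound (s := raySetoid _)
      (rayEquiv_of_infinite H.1 H.2 (not_exceptional_of_mem_endsClass ⟨f⟩) r r')
  exact absurd (f.symm.injective hsub) (by decide)

theorem eventually_false_of_finite {s : Gen} {ξ : ℕ → Bool}
    (h : {i | lineBits s ξ i = true}.Finite) :
    ∀ᶠ j in atTop, j % 2 = s.residue → ξ j = false := by
  obtain ⟨N, hN⟩ := h.bddAbove
  filter_upwards [eventually_gt_atTop (2 * N + 1)] with j hj hjs
  by_contra hne
  have hmem : lineBits s ξ (j / 2) = true := by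
    rw [lineBits, ← s.eq_two_mul_add hjs]
    simpa using hne
  have := hN hmem
  omega

theorem not_finite_and_finite {ξ : ℕ → Bool} (hξ : ¬ Exceptional ξ) :
    ¬ ({i | alphaBit ξ i = true}.Finite ∧ {i | betaBit ξ i = true}.Finite) := by
  rintro ⟨h₀, h₁⟩
  refine hξ (Or.inl ?_)
  filter_upwards [eventually_false_of_finite (s := .b) h₀, eventually_false_of_finite (s := .a) h₁]
    with j hb ha
  rcases Nat.mod_two_eq_zero_or_one j with h | h
  · exact hb h
  · exact ha h

/-! ### Constructing isomorphisms of multigraphs -/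

/-- The inverse of an isomorphism of multigraphs. -/
def GraphIso.symm {V₁ E₁ V₂ E₂ : Type*} {G : Graph V₁ E₁} {H : Graph V₂ E₂} (f : GraphIso G H) :
    GraphIso H G where
  vertexEquiv := f.vertexEquiv.symm
  edgeEquiv := f.edgeEquiv.symm
  isLink_iff e x y := by simpa using (f.isLink_iff (f.edgeEquiv.symm e) (f.vertexEquiv.symm x)
    (f.vertexEquiv.symm y)).symm

/-- A homomorphism of multigraphs that is bijective on vertices and on edges is an isomorphism. -/
noncomputable def GraphIso.ofBijOn {V₁ E₁ V₂ E₂ : Type*} {G : Graph V₁ E₁} {H : Graph V₂ E₂}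
    {φ : V₁ → V₂} {ψ : E₁ → E₂} (hφ : Set.BijOn φ G.vertexSet H.vertexSet)
    (hψ : Set.BijOn ψ G.edgeSet H.edgeSet)
    (hlink : ∀ e x y, G.IsLink e x y → H.IsLink (ψ e) (φ x) (φ y)) : GraphIso G H where
  vertexEquiv := hφ.equiv
  edgeEquiv := hψ.equiv
  isLink_iff e x y := by
    refine ⟨hlink e x y, fun h => ?_⟩
    have h : H.IsLink (ψ e) (φ x) (φ y) := h
    obtain ⟨e, he⟩ := e
    obtain ⟨u, v, huv⟩ := Graph.edgeSet_eq_setOfPred_exists_isLink (G := G) ▸ he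
    have heq := (hlink _ _ _ huv).eq_and_eq_or_eq_and_eq h
    rcases heq with ⟨h₁, h₂⟩ | ⟨h₁, h₂⟩
    · rwa [← hφ.injOn huv.left_mem x.2 h₁, ← hφ.injOn huv.right_mem y.2 h₂]
    · rw [← hφ.injOn huv.left_mem y.2 h₁, ← hφ.injOn huv.right_mem x.2 h₂]
      exact huv.symm

/-! ### The line in an orbit and the decorations along it -/

/-- The vertex `0` of the line: its odometer value is `1` plus the value of the bits of `ξ` other
than the first one. -/
def lineBase (s : Gen) (ξ : ℕ → Bool) : ℕ → Bool := fun j =>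
  if j % 2 = s.residue then (if j = s.residue then true else ξ j) else false

/-- The vertex `n` of the line. Since `s` decrements the odometer value, it is `s⁻ⁿ` applied to the
vertex `0`. -/
def lineVertex (s : Gen) (ξ : ℕ → Bool) (n : ℤ) : ℕ → Bool := (genSeq s ^ (-n)) (lineBase s ξ)

theorem onLine_lineBase (s : Gen) (ξ : ℕ → Bool) : OnLine s (lineBase s ξ) :=
  fun _ hj => if_neg hj

theorem onLine_lineVertex (s : Gen) (ξ : ℕ → Bool) (n : ℤ) : OnLine s (lineVertex s ξ n) :=
  (onLine_lineBase s ξ).zpow _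

theorem genSeq_lineVertex_succ (s : Gen) (ξ : ℕ → Bool) (n : ℤ) :
    genSeq s (lineVertex s ξ (n + 1)) = lineVertex s ξ n := by
  rw [lineVertex, genSeq_zpow_apply, lineVertex]
  congr 2
  ring

theorem lineVertex_injective (s : Gen) (ξ : ℕ → Bool) : Function.Injective (lineVertex s ξ) :=
  (zpow_genSeq_injective (onLine_lineBase s ξ)).comp neg_injective

theorem lineBase_eventuallyEq {s : Gen} {ξ : ℕ → Bool}
    (hoff : ∀ᶠ j in atTop, j % 2 ≠ s.residue → ξ j = false) : lineBase s ξ =ᶠ[atTop] ξ := by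
  filter_upwards [hoff, eventually_gt_atTop s.residue] with j hj hjs
  by_cases h : j % 2 = s.residue
  · rw [lineBase, if_pos h, if_neg hjs.ne']
  · rw [lineBase, if_neg h, hj h]

theorem bitsVal_lineBase (s : Gen) (ξ : ℕ → Bool) (k : ℕ) :
    bitsVal (lineBits s (lineBase s ξ)) (k + 1) =
      1 + ∑ i ∈ Finset.Icc 1 k, 2 ^ i * (if lineBits s ξ i then 1 else 0) := by
  have hs := s.residue_lt_two
  induction k with
  | zero => simp [bitsVal, lineBits, lineBase, Nat.mod_eq_of_lt hs]
  | succ k ih =>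
    rw [bitsVal_succ, ih, Finset.sum_Icc_succ_top (by omega), add_assoc]
    have : lineBits s (lineBase s ξ) (k + 1) = lineBits s ξ (k + 1) := by
      rw [lineBits, lineBase, if_pos (s.mod_two _), if_neg (by omega), lineBits]
    rw [this]

/-- The integer `n` lies in `A'_k` exactly when the vertex `n` of the line begins with
`0^{h-1}1`, where `h` is the size of the decoration to be attached there. -/
theorem mem_residueSet_iff {s : Gen} {ξ : ℕ → Bool} {n : ℤ} {k : ℕ} :
    n ∈ residueSet (lineBits s ξ) k ↔
      (∀ j < 2 * k + s.residue, lineVertex s ξ n j = false) ∧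
        lineVertex s ξ n (2 * k + s.residue) = true := by
  have h₁ : (∀ i < k + 1, lineBits s (lineVertex s ξ n) i = decide (i = k)) ↔
      (∀ j < 2 * k + s.residue, lineVertex s ξ n j = false) ∧
        lineVertex s ξ n (2 * k + s.residue) = true := by
    rw [Nat.forall_lt_succ_right, (onLine_lineVertex s ξ n).zero_below_iff]
    refine and_congr (forall₂_congr fun i hi => ?_) ?_
    · simp [hi.ne]
    · simp [lineBits]
  rw [← h₁, ← bitsVal_modEq_iff, bitsVal_single]
  have h₂ := bitsVal_lineBits_zpow_modEq (onLine_lineBase s ξ) (-n) (k + 1)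
  rw [bitsVal_lineBase, sub_neg_eq_add] at h₂
  change n ≡ _ [ZMOD _] ↔ bitsVal (lineBits s ((genSeq s ^ (-n)) (lineBase s ξ))) _ ≡ _ [ZMOD _]
  rw [Int.modEq_comm] at h₂
  set S := ∑ i ∈ Finset.Icc 1 k, 2 ^ i * (if lineBits s ξ i then (1 : ℤ) else 0)
  constructor
  · intro h
    refine h₂.symm.trans ?_
    have := h.add_left (1 + S)
    rwa [show 1 + S + (2 ^ k - 1 - S) = 2 ^ k by ring] at this
  · intro h
    have := (h₂.trans h).add_left (-1 - S)
    rwa [show -1 - S + (1 + S + n) = n by ring,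
      show -1 - S + 2 ^ k = 2 ^ k - 1 - S by ring] at this

theorem residueSet_unique {s : Gen} {ξ : ℕ → Bool} {n : ℤ} {k k' : ℕ}
    (h : n ∈ residueSet (lineBits s ξ) k) (h' : n ∈ residueSet (lineBits s ξ) k') : k = k' := by
  rw [mem_residueSet_iff] at h h'
  rcases lt_trichotomy k k' with hlt | rfl | hlt
  · simp [h'.1 (2 * k + s.residue) (by omega)] at h
  · rfl
  · simp [h.1 (2 * k' + s.residue) (by omega)] at h'

theorem lineVertex_eventuallyEq {s : Gen} {ξ : ℕ → Bool} (hξ : ¬ Exceptional ξ)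
    (hoff : ∀ᶠ j in atTop, j % 2 ≠ s.residue → ξ j = false) (n : ℤ) :
    lineVertex s ξ n =ᶠ[atTop] ξ :=
  eventuallyEq_of_mem_orbit hξ
    (zpow_genSeq_mem_orbit (mem_orbit_of_eventuallyEq (lineBase_eventuallyEq hoff)) s _)

theorem exists_mem_residueSet {s : Gen} {ξ : ℕ → Bool} (hξ : ¬ Exceptional ξ)
    (hoff : ∀ᶠ j in atTop, j % 2 ≠ s.residue → ξ j = false) (n : ℤ) :
    ∃ k, n ∈ residueSet (lineBits s ξ) k := by
  have hx := onLine_lineVertex s ξ n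
  have hne : ∃ i, lineBits s (lineVertex s ξ n) i = true := by
    by_contra! H
    have hz : lineVertex s ξ n = zeroSeq := hx.ext (onLine_zeroSeq s) fun i => by
      simpa [lineBits, zeroSeq] using H i
    exact hξ (Or.inl (hz ▸ (lineVertex_eventuallyEq hξ hoff n).symm))
  refine ⟨Nat.find hne, mem_residueSet_iff.mpr ⟨(hx.zero_below_iff _).mpr fun i hi => ?_,
    Nat.find_spec hne⟩⟩
  simpa using Nat.find_min hne hi

/-- The word `x` with its first `m` letters replaced by those of `w`. -/
def splice (m : ℕ) (w : List Bool) (x : ℕ → Bool) : ℕ → Bool := fun j =>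
  if j < m then w.getD j false else x j

theorem splice_wordPrefix_of_lt {m j : ℕ} (z x : ℕ → Bool) (h : j < m) :
    splice m (wordPrefix (m + 1) z) x j = z j := by
  rw [splice, if_pos h, getD_wordPrefix z (by omega)]

theorem splice_of_le {m j : ℕ} (w : List Bool) (x : ℕ → Bool) (h : m ≤ j) :
    splice m w x j = x j := if_neg (by omega)

theorem splice_eventuallyEq (m : ℕ) (w : List Bool) (x : ℕ → Bool) :
    splice m w x =ᶠ[atTop] x := by
  filter_upwards [eventually_ge_atTop m] with j hj using splice_of_le w x hj

theorem exists_of_mem_decorationVerts {s : Gen} {k : ℕ} {w : List Bool}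
    (hw : w ∈ decorationVerts (2 * k + s.residue + 1)) :
    ∃ z, w = wordPrefix (2 * k + s.residue + 1) z ∧ z (2 * k + s.residue) = false ∧
      ((∀ j < 2 * k + s.residue + 1, z j = false) ∨
        LastOne (2 * k + s.residue + 1) (1 - s.residue) z) := by
  have hs := s.residue_lt_two
  obtain ⟨z, hz⟩ := exists_wordPrefix w
  have hlen : w.length = 2 * k + s.residue + 1 := by
    rcases hw with rfl | h
    · simp [zeros]
    · exact h.1
  rw [hlen] at hz
  subst hz
  have h := (mem_decorationVerts_iff s k).mp hw
  refine ⟨z, rfl, ?_, h⟩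
  rcases h with h | ⟨p, hp, hpr, -, hlast⟩
  · exact h _ (by omega)
  · have := s.mod_two k
    exact hlast _ (by omega) (by omega)

/-- A word determines the vertex of the line and the decoration vertex from which it is obtained:
the decoration ends at the first line position with letter `1` after which all letters off the line
positions are `0`. -/
theorem splice_injective {s : Gen} {ξ : ℕ → Bool} {n n' : ℤ} {k k' : ℕ} {w w' : List Bool}
    (hn : n ∈ residueSet (lineBits s ξ) k) (hn' : n' ∈ residueSet (lineBits s ξ) k')
    (hw : w ∈ decorationVerts (2 * k + s.residue + 1))
    (hw' : w' ∈ decorationVerts (2 * k' + s.residue + 1))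
    (h : splice (2 * k + s.residue) w (lineVertex s ξ n) =
      splice (2 * k' + s.residue) w' (lineVertex s ξ n')) :
    n = n' ∧ k = k' ∧ w = w' := by
  have hlt : ∀ {n n' : ℤ} {k k' : ℕ} {w w' : List Bool},
      n ∈ residueSet (lineBits s ξ) k →
      w' ∈ decorationVerts (2 * k' + s.residue + 1) →
      splice (2 * k + s.residue) w (lineVertex s ξ n) =
        splice (2 * k' + s.residue) w' (lineVertex s ξ n') → ¬ k < k' := by
    intro n n' k k' w w' hn hw' h hlt
    have hs := s.residue_lt_two
    have hk := s.mod_two k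
    obtain ⟨z, rfl, -, hz⟩ := exists_of_mem_decorationVerts hw'
    have hX (j : ℕ) (h₁ : 2 * k + s.residue ≤ j) (h₂ : j < 2 * k' + s.residue) :
        z j = lineVertex s ξ n j := by
      rw [← splice_wordPrefix_of_lt z (lineVertex s ξ n') h₂, ← h, splice_of_le _ _ h₁]
    have hzk : z (2 * k + s.residue) = true := by
      rw [hX _ le_rfl (by omega), (mem_residueSet_iff.mp hn).2]
    rcases hz with hz | ⟨p, hp, hpr, hzp, hlast⟩
    · simp [hz (2 * k + s.residue) (by omega)] at hzk
    · have hkp : 2 * k + s.residue ≤ p := by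
        by_contra! hlt
        simp [hlast _ hlt (by omega)] at hzk
      have hk' := s.mod_two k'
      rw [hX p hkp (by omega), onLine_lineVertex s ξ n p (by omega)] at hzp
      simp at hzp
  obtain rfl : k = k' :=
    le_antisymm (not_lt.mp (hlt hn' hw h.symm)) (not_lt.mp (hlt hn hw' h))
  rw [mem_residueSet_iff] at hn hn'
  obtain ⟨z, rfl, hz, -⟩ := exists_of_mem_decorationVerts hw
  obtain ⟨z', rfl, hz', -⟩ := exists_of_mem_decorationVerts hw'
  refine ⟨lineVertex_injective s ξ (funext fun j => ?_), rfl, wordPrefix_eq_iff.mpr ?_⟩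
  · rcases lt_or_ge j (2 * k + s.residue) with hj | hj
    · rw [hn.1 j hj, hn'.1 j hj]
    · have := congr_fun h j
      rwa [splice_of_le _ _ hj, splice_of_le _ _ hj] at this
  · refine Nat.forall_lt_succ_right.mpr ⟨fun j hj => ?_, hz.trans hz'.symm⟩
    have := congr_fun h j
    rwa [splice_wordPrefix_of_lt _ _ hj, splice_wordPrefix_of_lt _ _ hj] at this

theorem splice_zeros {s : Gen} {ξ : ℕ → Bool} {n : ℤ} {k : ℕ}
    (hn : n ∈ residueSet (lineBits s ξ) k) :
    splice (2 * k + s.residue) (zeros (2 * k + s.residue + 1)) (lineVertex s ξ n) =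
      lineVertex s ξ n := by
  funext j
  rcases lt_or_ge j (2 * k + s.residue) with hj | hj
  · rw [zeros_eq_wordPrefix, splice_wordPrefix_of_lt _ _ hj, (mem_residueSet_iff.mp hn).1 j hj]
    rfl
  · rw [splice_of_le _ _ hj]

/-- Every vertex of the orbit lies on a decoration of the line. -/
theorem exists_splice {s : Gen} {ξ x : ℕ → Bool} (hξ : ¬ Exceptional ξ)
    (hoff : ∀ᶠ j in atTop, j % 2 ≠ s.residue → ξ j = false) (hx : x =ᶠ[atTop] ξ) :
    ∃ n k w, n ∈ residueSet (lineBits s ξ) k ∧ w ∈ decorationVerts (2 * k + s.residue + 1) ∧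
      splice (2 * k + s.residue) w (lineVertex s ξ n) = x := by
  classical
  have hs := s.residue_lt_two
  have hxoff : ∀ᶠ j in atTop, j % 2 ≠ s.residue → x j = false := by
    filter_upwards [hoff, hx] with j h₁ h₂ h₃ using h₂.trans (h₁ h₃)
  obtain ⟨N, hN⟩ := eventually_atTop.mp hxoff
  have hP : ∃ i, x (2 * i + s.residue) = true ∧
      ∀ j > 2 * i + s.residue, j % 2 ≠ s.residue → x j = false := by
    by_contra! H
    -- otherwise `x`, and hence `ξ`, has the tail of `000…`
    refine hξ (Or.inl (hx.symm.trans (eventually_atTop.mpr ⟨N, fun j hj => ?_⟩)))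
    by_cases hjs : j % 2 = s.residue
    · by_contra hne
      have hxj : x (2 * (j / 2) + s.residue) = true := by
        rw [← s.eq_two_mul_add hjs]; simpa [zeroSeq] using hne
      obtain ⟨i, hi, his, hxi⟩ := H _ hxj
      exact hxi (hN i (by omega) his)
    · exact hN j hj hjs
  obtain ⟨hk, hkoff⟩ := Nat.find_spec hP
  have hmin := @Nat.find_min _ _ hP
  set k := Nat.find hP with hk_def
  clear_value k
  set m := 2 * k + s.residue with hm
  have hmmod : m % 2 = s.residue := s.mod_two k
  have hline : OnLine s (zeroBelow m x) := by
    intro j hj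
    rcases lt_or_ge j m with h | h
    · exact zeroBelow_of_lt x h
    · rw [zeroBelow_of_le x h]
      exact hkoff j (lt_of_le_of_ne h (by rintro rfl; exact hj hmmod)) hj
  have htail : lineBase s ξ =ᶠ[atTop] zeroBelow m x := by
    refine ((lineBase_eventuallyEq hoff).trans hx.symm).trans ?_
    filter_upwards [eventually_ge_atTop m] with j hj using (zeroBelow_of_le x hj).symm
  obtain ⟨t, ht⟩ := exists_zpow_eq (onLine_lineBase s ξ) hline htail
  have hvert : lineVertex s ξ (-t) = zeroBelow m x := by rw [lineVertex, neg_neg, ht]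
  refine ⟨-t, k, wordPrefix (m + 1) (fun j => if j < m then x j else false), ?_, ?_, ?_⟩
  · rw [mem_residueSet_iff, hvert]
    exact ⟨fun j hj => zeroBelow_of_lt x hj, (zeroBelow_of_le x le_rfl).trans hk⟩
  · rw [mem_decorationVerts_iff, or_iff_not_imp_left]
    intro hne
    obtain ⟨r, hr, p, hp, hpr, hxp, hlast⟩ := exists_lastOne
      (n := 2 * k + s.residue + 1) (x := fun j => if j < m then x j else false) (by simpa using hne)
    have hpm : p < m := by
      by_contra hpm
      simp [hpm] at hxp
    have hxp : x p = true := by simpa [hpm] using hxp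
    -- a last `1` at a line position would be a smaller candidate for the root of the decoration
    have hrs : r ≠ s.residue := by
      rintro rfl
      refine hmin (m := p / 2) (by omega) ⟨?_, fun j hj hjs => ?_⟩
      · rwa [← s.eq_two_mul_add hpr]
      · rw [← s.eq_two_mul_add hpr] at hj
        rcases lt_trichotomy j m with h | rfl | h
        · simpa [h] using hlast j hj (by omega)
        · exact absurd hmmod hjs
        · exact hkoff j h hjs
    exact ⟨p, by omega, by omega, by simp [hpm, hxp], hlast⟩
  · funext j
    rcases lt_or_ge j m with hj | hj
    · rw [splice_wordPrefix_of_lt _ _ hj, if_pos hj]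
    · rw [splice_of_le _ _ hj, hvert, zeroBelow_of_le x hj]

/-- Apart from the edge of the generator `s` at the root, the generators act on a decoration of the
line as on the finite one. -/
theorem genSeq_splice {s g : Gen} {ξ : ℕ → Bool} {n : ℤ} {k : ℕ} {w : List Bool}
    (hn : n ∈ residueSet (lineBits s ξ) k)
    (hw : w ∈ decorationVerts (2 * k + s.residue + 1))
    (hg : w = zeros (2 * k + s.residue + 1) → g ≠ s) :
    genWord g w ∈ decorationVerts (2 * k + s.residue + 1) ∧
      genSeq g (splice (2 * k + s.residue) w (lineVertex s ξ n)) =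
        splice (2 * k + s.residue) (genWord g w) (lineVertex s ξ n) := by
  have hs := s.residue_lt_two
  obtain ⟨z, rfl, hzk, hz⟩ := exists_of_mem_decorationVerts hw
  rw [genWord_wordPrefix, mem_decorationVerts_iff]
  rw [wordPrefix_eq_zeros_iff] at hg
  constructor
  · rw [or_iff_not_imp_left]
    intro hne
    have hne : ∃ j < 2 * k + s.residue + 1, genSeq g z j = true := by simpa using hne
    rcases hz with hz | hz
    · have hgs : g.residue ≠ s.residue := fun h => hg hz (Gen.residue_injective h)
      have hg2 := g.residue_lt_two
      rw [show 1 - s.residue = g.residue by omega]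
      exact lastOne_genSeq_of_zero hz hne
    · exact hz.genSeq_of_ne_zero hne
  · have hroot := (mem_residueSet_iff.mp hn).2
    set m := 2 * k + s.residue
    set x := lineVertex s ξ n
    have hXm : splice m (wordPrefix (m + 1) z) x m = true := by rw [splice_of_le _ _ le_rfl, hroot]
    funext j
    rcases lt_trichotomy j m with hj | rfl | hj
    · rw [splice_wordPrefix_of_lt _ _ hj]
      exact genSeq_congr fun i hi => splice_wordPrefix_of_lt _ _ (by omega)
    · rw [splice_of_le _ _ le_rfl]
      by_contra hne
      rw [← splice_of_le (m := m) (wordPrefix (m + 1) z) x le_rfl] at hne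
      obtain ⟨hzero, hres⟩ := flip_of_genSeq_ne hne
      refine hg (Nat.forall_lt_succ_right.mpr ⟨fun i hi => ?_, hzk⟩)
        (Gen.residue_injective (hres.symm.trans (s.mod_two k)))
      rw [← splice_wordPrefix_of_lt z x hi]
      exact hzero i hi
    · rw [splice_of_le _ _ hj.le, genSeq_of_true_lt hXm hj, splice_of_le _ _ hj.le]

theorem zeros_mem_decorationVerts (h : ℕ) : zeros h ∈ decorationVerts h := Or.inl rfl

/-- The edge of `s` at the root of a decoration leaves the decoration. -/
theorem genWord_zeros_notMem (s : Gen) (k : ℕ) :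
    genWord s (zeros (2 * k + s.residue + 1)) ∉ decorationVerts (2 * k + s.residue + 1) := by
  intro h
  obtain ⟨z, hz, hzk, -⟩ := exists_of_mem_decorationVerts h
  rw [zeros_eq_wordPrefix, genWord_wordPrefix, wordPrefix_eq_iff] at hz
  have := hz (2 * k + s.residue) (by omega)
  rw [genSeq_zeroSeq, s.mod_two, hzk] at this
  simp at this

/-! ### The isomorphism -/

theorem decoration_isLink_iff {h : ℕ} {w u v : List Bool} {g : Gen} :
    (decoration h).IsLink (w, g) u v ↔
      w ∈ decorationVerts h ∧ genWord g w ∈ decorationVerts h ∧ s(u, v) = s(w, genWord g w) := by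
  have hlen : w ∈ decorationVerts h → w.length = h := by
    rintro (rfl | h')
    · simp [zeros]
    · exact h'.1
  rw [decoration, Graph.induce_isLink]
  constructor
  · rintro ⟨⟨-, h⟩, hu, hv⟩
    have h : s(u, v) = s(w, genWord g w) := h
    rcases Sym2.eq_iff.mp h with ⟨rfl, rfl⟩ | ⟨rfl, rfl⟩
    · exact ⟨hu, hv, rfl⟩
    · exact ⟨hv, hu, Sym2.eq_swap⟩
  · rintro ⟨hw, hgw, h⟩
    refine ⟨⟨hlen hw, h⟩, ?_⟩
    rcases Sym2.eq_iff.mp h with ⟨rfl, rfl⟩ | ⟨rfl, rfl⟩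
    · exact ⟨hw, hgw⟩
    · exact ⟨hgw, hw⟩

/-- The line with a decoration of size `h k` at every vertex of `A'_k`, for the bits of `ξ` at the
positions of the generator `s`. -/
def lineGraph (s : Gen) (ξ : ℕ → Bool) :
    Graph (ℤ ⊕ (ℤ × ℕ × List Bool)) (ℤ ⊕ (ℤ × ℕ × (List Bool × Gen))) :=
  decoratedLine (residueSet (lineBits s ξ)) (fun k => 2 * k + s.residue + 1)

/-- The map from the vertices of the decorated line to the orbit. -/
def vertexMap (s : Gen) (ξ : ℕ → Bool) : ℤ ⊕ (ℤ × ℕ × List Bool) → ℕ → Bool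
  | Sum.inl n => lineVertex s ξ n
  | Sum.inr (n, k, w) => splice (2 * k + s.residue) w (lineVertex s ξ n)

/-- The map from the edges of the decorated line to those of the orbital graph. The edges of the
line are the `s`-edges of its vertices. -/
def edgeMap (s : Gen) (ξ : ℕ → Bool) : ℤ ⊕ (ℤ × ℕ × (List Bool × Gen)) → (ℕ → Bool) × Gen
  | Sum.inl n => (lineVertex s ξ (n + 1), s)
  | Sum.inr (n, k, (w, g)) => (splice (2 * k + s.residue) w (lineVertex s ξ n), g)

theorem vertexMap_attachVertex {s : Gen} {ξ : ℕ → Bool} {n : ℤ} {k : ℕ}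
    (hn : n ∈ residueSet (lineBits s ξ) k) (w : List Bool) :
    vertexMap s ξ (attachVertex (2 * k + s.residue + 1) n k w) =
      splice (2 * k + s.residue) w (lineVertex s ξ n) := by
  rw [attachVertex]
  split_ifs with h
  · rw [h, splice_zeros hn]; rfl
  · rfl

theorem exists_attachVertex {s : Gen} {ξ : ℕ → Bool} (hξ : ¬ Exceptional ξ)
    (hoff : ∀ᶠ j in atTop, j % 2 ≠ s.residue → ξ j = false) {v : ℤ ⊕ (ℤ × ℕ × List Bool)}
    (hv : v ∈ (lineGraph s ξ).vertexSet) :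
    ∃ n k w, n ∈ residueSet (lineBits s ξ) k ∧ w ∈ decorationVerts (2 * k + s.residue + 1) ∧
      v = attachVertex (2 * k + s.residue + 1) n k w := by
  rcases hv with ⟨n, rfl⟩ | ⟨n, k, hn, w, hw, rfl⟩
  · obtain ⟨k, hk⟩ := exists_mem_residueSet hξ hoff n
    exact ⟨n, k, _, hk, zeros_mem_decorationVerts _, (if_pos rfl).symm⟩
  · exact ⟨n, k, w, hn, hw, rfl⟩

theorem bijOn_vertexMap {s : Gen} {ξ : ℕ → Bool} (hξ : ¬ Exceptional ξ)
    (hoff : ∀ᶠ j in atTop, j % 2 ≠ s.residue → ξ j = false) :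
    Set.BijOn (vertexMap s ξ) (lineGraph s ξ).vertexSet (orbitalSchreierGraph ξ).vertexSet := by
  refine ⟨fun v hv => ?_, fun v hv v' hv' h => ?_, fun x hx => ?_⟩
  · obtain ⟨n, k, w, hn, hw, rfl⟩ := exists_attachVertex hξ hoff hv
    rw [vertexMap_attachVertex hn]
    exact mem_orbit_of_eventuallyEq
      ((splice_eventuallyEq _ _ _).trans (lineVertex_eventuallyEq hξ hoff n))
  · obtain ⟨n, k, w, hn, hw, rfl⟩ := exists_attachVertex hξ hoff hv
    obtain ⟨n', k', w', hn', hw', rfl⟩ := exists_attachVertex hξ hoff hv'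
    rw [vertexMap_attachVertex hn, vertexMap_attachVertex hn'] at h
    obtain ⟨rfl, rfl, rfl⟩ := splice_injective hn hn' hw hw' h
    rfl
  · obtain ⟨n, k, w, hn, hw, rfl⟩ := exists_splice hξ hoff (eventuallyEq_of_mem_orbit hξ hx)
    exact ⟨_, Or.inr ⟨n, k, hn, w, hw, rfl⟩, vertexMap_attachVertex hn w⟩

theorem inl_mem_edgeSet (s : Gen) (ξ : ℕ → Bool) (n : ℤ) :
    Sum.inl n ∈ (lineGraph s ξ).edgeSet := by
  rw [Graph.edgeSet_eq_setOfPred_exists_isLink]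
  exact ⟨Sum.inl n, Sum.inl (n + 1), rfl⟩

theorem inr_mem_edgeSet_iff {s : Gen} {ξ : ℕ → Bool} {n : ℤ} {k : ℕ} {w : List Bool} {g : Gen} :
    Sum.inr (n, k, (w, g)) ∈ (lineGraph s ξ).edgeSet ↔
      n ∈ residueSet (lineBits s ξ) k ∧ w ∈ decorationVerts (2 * k + s.residue + 1) ∧
        genWord g w ∈ decorationVerts (2 * k + s.residue + 1) := by
  rw [Graph.edgeSet_eq_setOfPred_exists_isLink]
  constructor
  · rintro ⟨x, y, hn, u, v, he, -, -⟩
    have := decoration_isLink_iff.mp he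
    exact ⟨hn, this.1, this.2.1⟩
  · rintro ⟨hn, hw, hgw⟩
    exact ⟨_, _, hn, w, genWord g w, decoration_isLink_iff.mpr ⟨hw, hgw, rfl⟩, rfl, rfl⟩

theorem mem_edgeSet_orbitalSchreierGraph {ξ : ℕ → Bool} {e : (ℕ → Bool) × Gen} :
    e ∈ (orbitalSchreierGraph ξ).edgeSet ↔ e.1 ∈ MulAction.orbit basilicaGroup ξ := by
  rw [Graph.edgeSet_eq_setOfPred_exists_isLink]
  exact ⟨fun ⟨_, _, h, _⟩ => h, fun h => ⟨_, _, h, rfl⟩⟩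

theorem ne_of_mem_decorationVerts {s g : Gen} {k : ℕ} {w : List Bool}
    (hgw : genWord g w ∈ decorationVerts (2 * k + s.residue + 1)) :
    w = zeros (2 * k + s.residue + 1) → g ≠ s := by
  rintro rfl rfl
  exact genWord_zeros_notMem g k hgw

theorem bijOn_edgeMap {s : Gen} {ξ : ℕ → Bool} (hξ : ¬ Exceptional ξ)
    (hoff : ∀ᶠ j in atTop, j % 2 ≠ s.residue → ξ j = false) :
    Set.BijOn (edgeMap s ξ) (lineGraph s ξ).edgeSet (orbitalSchreierGraph ξ).edgeSet := by
  -- a line edge and a decoration edge have different images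
  have hdisj {n n' : ℤ} {k : ℕ} {w : List Bool} {g : Gen}
      (he : Sum.inr (n', k, (w, g)) ∈ (lineGraph s ξ).edgeSet)
      (h : edgeMap s ξ (Sum.inl n) = edgeMap s ξ (Sum.inr (n', k, (w, g)))) : False := by
    obtain ⟨hn', hw, hgw⟩ := inr_mem_edgeSet_iff.mp he
    obtain ⟨k', hk'⟩ := exists_mem_residueSet hξ hoff (n + 1)
    obtain ⟨h₁, h₂⟩ := Prod.ext_iff.mp h
    have h₁ : lineVertex s ξ (n + 1) = splice (2 * k + s.residue) w (lineVertex s ξ n') := h₁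
    rw [← splice_zeros hk'] at h₁
    obtain ⟨-, rfl, rfl⟩ := splice_injective hk' hn' (zeros_mem_decorationVerts _) hw h₁
    exact ne_of_mem_decorationVerts hgw rfl h₂.symm
  refine ⟨fun e he => ?_, fun e he e' he' h => ?_, fun e he => ?_⟩
  · rw [mem_edgeSet_orbitalSchreierGraph]
    rcases e with n | ⟨n, k, w, g⟩
    · exact mem_orbit_of_eventuallyEq (lineVertex_eventuallyEq hξ hoff _)
    · exact mem_orbit_of_eventuallyEq
        ((splice_eventuallyEq _ _ _).trans (lineVertex_eventuallyEq hξ hoff n))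
  · rcases e with n | ⟨n, k, w, g⟩ <;> rcases e' with n' | ⟨n', k', w', g'⟩
    · have := lineVertex_injective s ξ (Prod.ext_iff.mp h).1
      rw [add_right_cancel this]
    · exact (hdisj he' h).elim
    · exact (hdisj he h.symm).elim
    · obtain ⟨hn, hw, -⟩ := inr_mem_edgeSet_iff.mp he
      obtain ⟨hn', hw', -⟩ := inr_mem_edgeSet_iff.mp he'
      obtain ⟨h₁, h₂⟩ := Prod.ext_iff.mp h
      obtain ⟨rfl, rfl, rfl⟩ := splice_injective hn hn' hw hw' h₁
      obtain rfl : g = g' := h₂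
      rfl
  · rw [mem_edgeSet_orbitalSchreierGraph] at he
    obtain ⟨x, g⟩ := e
    obtain ⟨n, k, w, hn, hw, rfl⟩ := exists_splice hξ hoff (eventuallyEq_of_mem_orbit hξ he)
    by_cases hwg : w = zeros (2 * k + s.residue + 1) ∧ g = s
    · obtain ⟨rfl, rfl⟩ := hwg
      refine ⟨Sum.inl (n - 1), inl_mem_edgeSet g ξ _, ?_⟩
      rw [splice_zeros hn, edgeMap, sub_add_cancel]
    · exact ⟨Sum.inr (n, k, (w, g)), inr_mem_edgeSet_iff.mpr ⟨hn, hw,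
        (genSeq_splice hn hw fun h h' => hwg ⟨h, h'⟩).1⟩, rfl⟩

theorem isLink_edgeMap {s : Gen} {ξ : ℕ → Bool} (hξ : ¬ Exceptional ξ)
    (hoff : ∀ᶠ j in atTop, j % 2 ≠ s.residue → ξ j = false)
    (e : ℤ ⊕ (ℤ × ℕ × (List Bool × Gen))) (x y : ℤ ⊕ (ℤ × ℕ × List Bool))
    (h : (lineGraph s ξ).IsLink e x y) :
    (orbitalSchreierGraph ξ).IsLink (edgeMap s ξ e) (vertexMap s ξ x) (vertexMap s ξ y) := by
  refine ⟨mem_edgeSet_orbitalSchreierGraph.mp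
    ((bijOn_edgeMap hξ hoff).mapsTo h.edge_mem), ?_⟩
  rcases e with n | ⟨n, k, w, g⟩
  · have h : s(x, y) = s(Sum.inl n, Sum.inl (n + 1)) := h
    have h' := congr_arg (Sym2.map (vertexMap s ξ)) h
    rw [Sym2.map_mk, Sym2.map_mk] at h'
    refine h'.trans ?_
    change s(lineVertex s ξ n, lineVertex s ξ (n + 1)) =
      s(lineVertex s ξ (n + 1), genSeq s (lineVertex s ξ (n + 1)))
    rw [genSeq_lineVertex_succ, Sym2.eq_swap]
  · obtain ⟨hn, u, v, he, rfl, rfl⟩ := h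
    obtain ⟨hw, hgw, huv⟩ := decoration_isLink_iff.mp he
    have h' := congr_arg
      (Sym2.map fun w => splice (2 * k + s.residue) w (lineVertex s ξ n)) huv
    rw [Sym2.map_mk, Sym2.map_mk] at h'
    rw [vertexMap_attachVertex hn, vertexMap_attachVertex hn]
    refine h'.trans ?_
    rw [← (genSeq_splice hn hw (ne_of_mem_decorationVerts hgw)).2]
    rfl

/-- The case of a word whose letters off the positions of the generator `s` are eventually `0`. -/
theorem existsUnique_and_nonempty_graphIso {s : Gen} {ξ : ℕ → Bool} (hξ : ¬ Exceptional ξ)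
    (hoff : ∀ᶠ j in atTop, j % 2 ≠ s.residue → ξ j = false) :
    (∀ n : ℤ, ∃! k : ℕ, n ∈ residueSet (lineBits s ξ) k) ∧
      Nonempty (GraphIso (orbitalSchreierGraph ξ) (lineGraph s ξ)) := by
  refine ⟨fun n => ?_, ⟨(GraphIso.ofBijOn (bijOn_vertexMap hξ hoff) (bijOn_edgeMap hξ hoff)
    (isLink_edgeMap hξ hoff)).symm⟩⟩
  obtain ⟨k, hk⟩ := exists_mem_residueSet hξ hoff n
  exact ⟨k, hk, fun k' hk' => residueSet_unique hk' hk⟩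

end BasilicaSchreier

theorem mainTheorem4 (ξ : ℕ → Bool) (hξ : ξ ∈ BasilicaSchreier.endsClass 2) :
    -- exactly one of the two cases occurs
    Xor (ξ ∈ BasilicaSchreier.E2Even) (ξ ∈ BasilicaSchreier.E2Odd) ∧
    -- even case: every integer carries exactly one decoration, and `Γ_ξ` is isomorphic to `Γ(ξ)`
    (ξ ∈ BasilicaSchreier.E2Even →
      (∀ n : ℤ, ∃! k : ℕ, n ∈ BasilicaSchreier.residueSet (BasilicaSchreier.betaBit ξ) k) ∧
      Nonempty (BasilicaSchreier.GraphIso (BasilicaSchreier.orbitalSchreierGraph ξ)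
        (BasilicaSchreier.evenGraph ξ))) ∧
    -- odd case
    (ξ ∈ BasilicaSchreier.E2Odd →
      (∀ n : ℤ, ∃! k : ℕ, n ∈ BasilicaSchreier.residueSet (BasilicaSchreier.alphaBit ξ) k) ∧
      Nonempty (BasilicaSchreier.GraphIso (BasilicaSchreier.orbitalSchreierGraph ξ)
        (BasilicaSchreier.oddGraph ξ))) := by
  have hexc := BasilicaSchreier.not_exceptional_of_mem_endsClass hξ
  have hnot := BasilicaSchreier.not_finite_and_finite hexc
  refine ⟨?_, fun h => ?_, fun h => ?_⟩
  · rcases BasilicaSchreier.finite_or_finite_of_mem_endsClass hξ with h | h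
    · exact Or.inl ⟨⟨hξ, h⟩, fun h' => hnot ⟨h, h'.2⟩⟩
    · exact Or.inr ⟨⟨hξ, h⟩, fun h' => hnot ⟨h'.2, h⟩⟩
  · refine BasilicaSchreier.existsUnique_and_nonempty_graphIso (s := .a) hexc ?_
    filter_upwards [BasilicaSchreier.eventually_false_of_finite (s := .b) h.2] with j hj hja
    exact hj ((Nat.mod_two_eq_zero_or_one j).resolve_right hja)
  · refine BasilicaSchreier.existsUnique_and_nonempty_graphIso (s := .b) hexc ?_
    filter_upwards [BasilicaSchreier.eventually_false_of_finite (s := .a) h.2] with j hj hjb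
    exact hj ((Nat.mod_two_eq_zero_or_one j).resolve_left hjb)
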